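/- Let $V_4=\{1,x_1,x_2,x_3\}\subset SO(3)$ be the Klein four-group with $x_1=\mathrm{diag}(1,-1,-1)$, $x_2=\mathrm{diag}(-1,1,-1)$, $x_3=\mathrm{diag}(-1,-1,1)$, and let $T^2$ be the torus. For a homomorphism $\eta:\pi_1(T^2)\to SO(3)$ let $E_\eta=\widetilde{T^2}\times_{\pi_1(T^2)}SO(3)$ denote the associated flat principal $SO(3)$-bundle over $T^2$, and let $w_2(E_\eta)\in H^2(T^2;\mathbb{Z}/2)$ be its second Stiefel--Whitney class, that is, the primary obstruction to a section of $E_\eta$, with coefficients in $\pi_1(SO(3))=\mathbb{Z}/2$. (1) Let $a,b$ be a basis of $\pi_1(T^2)=H_1(T^2;\mathbb{Z})\cong\mathbb{Z}\oplus\mathbb{Z}$ and let $\eta:\pi_1(T^2)\to SO(3)$ be a homomorphism such that $\eta(a)$ and $\eta(b)$ are two distinct non-identity elements of $V_4$ (for example $\eta(a)=x_1$, $\eta(b)=x_2$). Then $H^2(T^2;\mathbb{Z}/2)\cong\mathbb{Z}/2$ and $w_2(E_\eta)$ is its non-zero element: \[ w_2(E_\eta)=1\in H^2(T^2;\mathbb{Z}/2)=\mathbb{Z}/2.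 \] (2) For every homomorphism $\eta:\pi_1(T^2)\to V_4$, one has $w_2(E_\eta)\neq 0$ if and only if $\eta$ is surjective. -/

import Mathlib

noncomputable section

/-! ### Singular cohomology, through the explicit complex of singular cochains -/

/-- The topological `n`-simplex. -/
abbrev Simp (n : ℕ) : Type := stdSimplex ℝ (Fin (n + 1))

/-- The inclusion of the `i`-th face (the one opposite to the vertex `i`). -/
def simpFace (n : ℕ) (i : Fin (n + 2)) : C(Simp n, Simp (n + 1)) :=
  ⟨stdSimplex.map i.succAbove, stdSimplex.continuous_map _⟩

/-- Singular `n`-cochains of `X` with values in `A`: functions on the singular `n`-simplices. -/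
abbrev SingularCochain (X : Type*) [TopologicalSpace X] (A : Type*) (n : ℕ) : Type _ :=
  C(Simp n, X) → A

/-- The coboundary `(δ f)(σ) = ∑ i, (-1) ^ i f(σ ∘ dᵢ)`. -/
def singularCoboundary (X : Type*) [TopologicalSpace X] (A : Type*) [AddCommGroup A] (n : ℕ) :
    SingularCochain X A n →+ SingularCochain X A (n + 1) where
  toFun f σ := ∑ i : Fin (n + 2), (-1 : ℤ) ^ (i : ℕ) • f (σ.comp (simpFace n i))
  map_zero' := by
    funext σ
    simp
  map_add' f g := by
    funext σ
    simp [Finset.sum_add_distrib]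

/-- Singular 2-cocycles. -/
abbrev SingularTwoCocycle (X : Type*) [TopologicalSpace X] (A : Type*) [AddCommGroup A] :
    AddSubgroup (SingularCochain X A 2) :=
  (singularCoboundary X A 2).ker

/-- `H²(X; A)`: singular 2-cocycles modulo coboundaries of singular 1-cochains. -/
abbrev SingularH2 (X : Type*) [TopologicalSpace X] (A : Type*) [AddCommGroup A] : Type _ :=
  SingularTwoCocycle X A ⧸
    ((singularCoboundary X A 1).range.addSubgroupOf (SingularTwoCocycle X A))

/-! ### Principal bundles -/

/-- `p : E → X` is a (topological, locally trivial) principal `G`-bundle, the group `G` acting on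
`E` from the right. -/
structure IsPrincipalBundle (G : Type*) [Group G] [TopologicalSpace G] {E X : Type*}
    [TopologicalSpace E] [TopologicalSpace X] [MulAction Gᵐᵒᵖ E] (p : E → X) : Prop where
  continuous_proj : Continuous p
  continuous_smul : ContinuousSMul Gᵐᵒᵖ E
  locally_trivial : ∀ x : X, ∃ U : Set X, IsOpen U ∧ x ∈ U ∧
    ∃ φ : (U × G) ≃ₜ (p ⁻¹' U), ∀ (u : U) (g : G),
      p (φ (u, g)) = u ∧
      ∀ h : G, (φ (u, g * h) : E) = MulOpposite.op h • (φ (u, g) : E)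

/-! ### The second Stiefel–Whitney class of a principal `SO(3)`-bundle -/

/-- The rotation group `SO(3)`. -/
abbrev SO3 : Type := Matrix.specialOrthogonalGroup (Fin 3) ℝ

/-- A section of `p : E → X` over the 1-skeleton of the singular complex of `X`: a point over each
point of `X`, and over each singular 1-simplex of `X` a lift with the prescribed end points. -/
structure OneSkeletonSection {E X : Type*} [TopologicalSpace E] [TopologicalSpace X]
    (p : E → X) where
  vertex : X → E
  proj_vertex : ∀ x, p (vertex x) = x
  edge : C(Simp 1, X) → C(Simp 1, E)
  proj_edge : ∀ σ t, p (edge σ t) = σ t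
  edge_vertex : ∀ σ (i : Fin 2),
    edge σ (stdSimplex.vertex i) = vertex (σ (stdSimplex.vertex i))

open Classical in
/-- The obstruction cochain of a section `s` over the 1-skeleton of a principal `SO(3)`-bundle.
The section given over the boundary of a singular 2-simplex `σ` is a loop in the fibre of the
(trivial) pullback `σ^* E`, and the obstruction to extending it over `σ` is its class in
`π₁(SO(3)) = ℤ/2`: this is `0` if there is an extension, and the other element if there is none. -/
def OneSkeletonSection.obstruction {E X : Type*} [TopologicalSpace E] [TopologicalSpace X]
    {p : E → X} (s : OneSkeletonSection p) : SingularCochain X (ZMod 2) 2 := fun σ =>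
  if ∃ τ : C(Simp 2, E), (∀ t, p (τ t) = σ t) ∧
      ∀ i : Fin 3, τ.comp (simpFace 1 i) = s.edge (σ.comp (simpFace 1 i))
  then 0 else 1

/-- `w` is the second Stiefel–Whitney class `w₂ ∈ H²(X; ℤ/2)` of the principal `SO(3)`-bundle
`p : E → X`: the primary obstruction to a section of `E`, which is the bundle of orthonormal
2-frames of the associated oriented vector bundle of rank 3. In other words, sections over the
1-skeleton exist, and the obstruction cochain of each of them is a cocycle that represents `w`.
There is at most one such `w`. -/
structure IsSecondStiefelWhitneyClass {E X : Type*} [TopologicalSpace E] [TopologicalSpace X]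
    [MulAction SO3ᵐᵒᵖ E] (p : E → X) (w : SingularH2 X (ZMod 2)) : Prop where
  principal : IsPrincipalBundle SO3 p
  exists_section : Nonempty (OneSkeletonSection p)
  represents : ∀ s : OneSkeletonSection p,
    ∃ h : s.obstruction ∈ SingularTwoCocycle X (ZMod 2),
      (QuotientAddGroup.mk (⟨s.obstruction, h⟩ : SingularTwoCocycle X (ZMod 2)) :
        SingularH2 X (ZMod 2)) = w

/-! ### The flat bundle of a representation of the fundamental group -/

/-- The space of paths in `X` that start at `x₀`, with the compact-open topology. -/
def PathsFrom {X : Type*} [TopologicalSpace X] (x₀ : X) : Type _ :=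
  {γ : C(unitInterval, X) // γ 0 = x₀}

instance {X : Type*} [TopologicalSpace X] (x₀ : X) : TopologicalSpace (PathsFrom x₀) :=
  inferInstanceAs (TopologicalSpace {γ : C(unitInterval, X) // γ 0 = x₀})

namespace PathsFrom

variable {X : Type*} [TopologicalSpace X] {x₀ : X}

/-- The end point of a path. -/
def target (γ : PathsFrom x₀) : X := γ.1 1

/-- An element of `PathsFrom x₀` as a path between two points. -/
def toPath (γ : PathsFrom x₀) : Path x₀ γ.target := ⟨γ.1, γ.2, rfl⟩

/-- For two paths with the same end point, the class in `π₁(X, x₀)` of the loop that runs along the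
first path and then back along the second one. -/
def loop (γ γ' : PathsFrom x₀) (h : γ'.target = γ.target) : FundamentalGroup X x₀ :=
  FundamentalGroup.fromPath
    (Path.Homotopic.Quotient.mk (γ.toPath.trans (γ'.toPath.cast rfl h.symm).symm))

end PathsFrom

/-- The relation on `PathsFrom x₀ × G` whose quotient is the flat bundle of `η`: it identifies
`(γ, g)` and `(γ', η [γ · γ'⁻¹] g)` whenever `γ` and `γ'` have the same end point. -/
def flatBundleRel {X : Type*} [TopologicalSpace X] {x₀ : X} {G : Type*} [Group G]
    (η : FundamentalGroup X x₀ →* G) (u v : PathsFrom x₀ × G) : Prop :=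
  ∃ h : v.1.target = u.1.target, v.2 = η (u.1.loop v.1 h) * u.2

/-- The total space of the flat principal `G`-bundle `E_η = X̃ ×_{π₁(X, x₀)} G` of a representation
`η` of the fundamental group, where the universal covering `X̃` consists of the homotopy classes of
paths starting at `x₀`; the topology is the quotient topology. The holonomy of `E_η` along a loop
`α` at `x₀` is the left multiplication by `η [α]` on the fibre. -/
def FlatBundle {X : Type*} [TopologicalSpace X] {x₀ : X} {G : Type*} [Group G]
    (η : FundamentalGroup X x₀ →* G) : Type _ :=
  Quot (flatBundleRel η)

namespace FlatBundle

variable {X : Type*} [TopologicalSpace X] {x₀ : X} {G : Type*} [Group G]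

instance [TopologicalSpace G] (η : FundamentalGroup X x₀ →* G) :
    TopologicalSpace (FlatBundle η) :=
  inferInstanceAs (TopologicalSpace (Quot (flatBundleRel η)))

/-- The projection of the flat bundle, `[γ, g] ↦ γ(1)`. -/
def proj (η : FundamentalGroup X x₀ →* G) : FlatBundle η → X :=
  Quot.lift (fun u => u.1.target) fun _ _ h => h.1.symm

/-- The right action `[γ, g] h = [γ, g h]`. -/
instance (η : FundamentalGroup X x₀ →* G) : MulAction Gᵐᵒᵖ (FlatBundle η) where
  smul h := Quot.map (fun u => (u.1, u.2 * h.unop)) (by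
    rintro u v ⟨h₁, h₂⟩
    exact ⟨h₁, by simp [h₂, mul_assoc]⟩)
  one_smul := by
    rintro ⟨u⟩
    exact congrArg (Quot.mk _) (Prod.ext rfl (mul_one _))
  mul_smul g h := by
    rintro ⟨u⟩
    exact congrArg (Quot.mk _) (Prod.ext rfl (mul_assoc _ _ _).symm)

end FlatBundle

/-! ### The torus and the Klein four-group -/

/-- The torus `T² = ℝ/ℤ × ℝ/ℤ`. -/
abbrev Torus : Type := UnitAddCircle × UnitAddCircle

/-- `a, b` is a basis of the group `π`, which is thus free abelian of rank 2. -/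
def IsFreeAbelianBasis {π : Type*} [Group π] (a b : π) : Prop :=
  ∃ e : π ≃* Multiplicative (ℤ × ℤ),
    e a = Multiplicative.ofAdd (1, 0) ∧ e b = Multiplicative.ofAdd (0, 1)

/-- A diagonal matrix with entries `±1` and determinant `1`, as an element of `SO(3)`. -/
def diagSO3 (d : Fin 3 → ℝ) (h : ∀ i, d i * d i = 1) (hd : d 0 * d 1 * d 2 = 1) : SO3 :=
  ⟨Matrix.diagonal d, by
    rw [Matrix.mem_specialOrthogonalGroup_iff, Matrix.mem_orthogonalGroup_iff]
    constructor
    · simp [h]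
    · simp [Fin.prod_univ_three, hd]⟩

/-- `x₁ = diag(1, -1, -1)`. -/
def kleinX₁ : SO3 :=
  diagSO3 ![1, -1, -1] (by simp [Fin.forall_fin_succ]) (by simp)

/-- `x₂ = diag(-1, 1, -1)`. -/
def kleinX₂ : SO3 :=
  diagSO3 ![-1, 1, -1] (by simp [Fin.forall_fin_succ]) (by simp)

/-- `x₃ = diag(-1, -1, 1)`. -/
def kleinX₃ : SO3 :=
  diagSO3 ![-1, -1, 1] (by simp [Fin.forall_fin_succ]) (by simp)

theorem klein_mul_self :
    kleinX₁ * kleinX₁ = 1 ∧ kleinX₂ * kleinX₂ = 1 ∧ kleinX₃ * kleinX₃ = 1 := by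
  refine ⟨?_, ?_, ?_⟩ <;>
  · apply Subtype.ext
    ext i j
    fin_cases i <;> fin_cases j <;> simp [kleinX₁, kleinX₂, kleinX₃, diagSO3]

theorem klein_mul :
    kleinX₁ * kleinX₂ = kleinX₃ ∧ kleinX₂ * kleinX₁ = kleinX₃ ∧
    kleinX₂ * kleinX₃ = kleinX₁ ∧ kleinX₃ * kleinX₂ = kleinX₁ ∧
    kleinX₁ * kleinX₃ = kleinX₂ ∧ kleinX₃ * kleinX₁ = kleinX₂ := by
  refine ⟨?_, ?_, ?_, ?_, ?_, ?_⟩ <;>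
  · apply Subtype.ext
    ext i j
    fin_cases i <;> fin_cases j <;> simp [kleinX₁, kleinX₂, kleinX₃, diagSO3]

/-- The Klein four-group `V₄ = {1, x₁, x₂, x₃}` of diagonal matrices in `SO(3)`. -/
def V₄ : Subgroup SO3 where
  carrier := {1, kleinX₁, kleinX₂, kleinX₃}
  one_mem' := by simp
  mul_mem' := by
    obtain ⟨h₁, h₂, h₃⟩ := klein_mul_self
    obtain ⟨k₁, k₂, k₃, k₄, k₅, k₆⟩ := klein_mul
    rintro _ _ (rfl | rfl | rfl | rfl) (rfl | rfl | rfl | rfl) <;>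
      simp [h₁, h₂, h₃, k₁, k₂, k₃, k₄, k₅, k₆]
  inv_mem' := by
    obtain ⟨h₁, h₂, h₃⟩ := klein_mul_self
    rintro _ (rfl | rfl | rfl | rfl) <;>
      simp [inv_eq_of_mul_eq_one_left h₁, inv_eq_of_mul_eq_one_left h₂,
        inv_eq_of_mul_eq_one_left h₃]

end

/-! The unit quaternions form a double cover `spin` of SO(3) with kernel ±1, and the 3-sphere is
simply connected. A loop in SO(3) is therefore null-homotopic exactly when it lifts to a closed loop
of quaternions, so every obstruction becomes a sign.

A flat bundle over the torus has coordinates along each lift of a simplex to the plane, and a change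
of the lift by a lattice vector multiplies them by the holonomy. Lifting the coordinates of a
section over the 1-skeleton to quaternions shows that its obstruction cochain is a coboundary plus
the pull-back of the 2-cocycle of ℤ² that measures the failure of chosen quaternion lifts of the
holonomy to be multiplicative (`exists_extension_iff`, `obstruction_eq`). This pull-back represents
w₂.

Evaluation on the two triangles of the unit square is injective on H²(T²; ℤ/2)
(`exists_primitive_of_evalFundamental`). On the extension cocycle it gives c(e₁,e₂) + c(e₂,e₁), the
sign of the commutator of the lifts of the two generators. Hence w₂ vanishes if and only if these
lifts commute (`torusExtClass_eq_zero_iff`). The lifts of x₁, x₂, x₃ are ±i, ±j, ±k, which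
anticommute pairwise; so w₂ ≠ 0 exactly when the generators go to distinct non-trivial elements of
V₄, that is, when the representation is onto. -/

noncomputable section

open Quaternion

/-! ### The double cover of the rotation group by the unit quaternions -/

/-- The group of unit quaternions. -/
abbrev UnitQuaternion : Type := Metric.sphere (0 : ℍ[ℝ]) 1

namespace UnitQuaternion

instance : Group UnitQuaternion := inferInstance

instance : IsTopologicalGroup UnitQuaternion := inferInstance

instance : HasDistribNeg UnitQuaternion := inferInstance

theorem sum_sq (a : UnitQuaternion) :
    (a : ℍ[ℝ]).re ^ 2 + (a : ℍ[ℝ]).imI ^ 2 + (a : ℍ[ℝ]).imJ ^ 2 + (a : ℍ[ℝ]).imK ^ 2 = 1 := by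
  rw [← Quaternion.normSq_def', Quaternion.normSq_eq_norm_mul_self, norm_eq_of_mem_sphere]
  norm_num

theorem norm_eq_one {q : ℍ[ℝ]} (h : q.re ^ 2 + q.imI ^ 2 + q.imJ ^ 2 + q.imK ^ 2 = 1) :
    ‖q‖ = 1 := by
  rw [← Quaternion.normSq_def', Quaternion.normSq_eq_norm_mul_self] at h
  exact (mul_self_inj (norm_nonneg _) zero_le_one).1 (h.trans (one_mul 1).symm)

/-- A unit quaternion from its components. -/
def mk (w x y z : ℝ) (h : w ^ 2 + x ^ 2 + y ^ 2 + z ^ 2 = 1) : UnitQuaternion :=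
  ⟨(⟨w, x, y, z⟩ : ℍ[ℝ]), mem_sphere_zero_iff_norm.2 (norm_eq_one h)⟩

end UnitQuaternion

/-- The matrix of `x ↦ a x ā` on the imaginary quaternions. -/
def rotMatrix (a : ℍ[ℝ]) : Matrix (Fin 3) (Fin 3) ℝ :=
  !![a.re ^ 2 + a.imI ^ 2 - a.imJ ^ 2 - a.imK ^ 2, 2 * (a.imI * a.imJ - a.re * a.imK),
      2 * (a.imI * a.imK + a.re * a.imJ);
    2 * (a.imI * a.imJ + a.re * a.imK), a.re ^ 2 - a.imI ^ 2 + a.imJ ^ 2 - a.imK ^ 2,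
      2 * (a.imJ * a.imK - a.re * a.imI);
    2 * (a.imI * a.imK - a.re * a.imJ), 2 * (a.imJ * a.imK + a.re * a.imI),
      a.re ^ 2 - a.imI ^ 2 - a.imJ ^ 2 + a.imK ^ 2]

theorem rotMatrix_mul (a b : ℍ[ℝ]) : rotMatrix (a * b) = rotMatrix a * rotMatrix b := by
  ext i j
  fin_cases i <;> fin_cases j <;>
    simp [rotMatrix, Matrix.mul_apply, Fin.sum_univ_three] <;> ring

theorem rotMatrix_one : rotMatrix 1 = 1 := by
  ext i j
  fin_cases i <;> fin_cases j <;> simp [rotMatrix]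

theorem continuous_rotMatrix : Continuous rotMatrix := by
  have h₀ := Quaternion.continuous_re
  have h₁ := Quaternion.continuous_imI
  have h₂ := Quaternion.continuous_imJ
  have h₃ := Quaternion.continuous_imK
  refine continuous_matrix fun i j => ?_
  fin_cases i <;> fin_cases j <;> simp [rotMatrix] <;> fun_prop

theorem rotMatrix_mem (a : UnitQuaternion) :
    rotMatrix a ∈ Matrix.specialOrthogonalGroup (Fin 3) ℝ := by
  have h := a.sum_sq
  rw [Matrix.mem_specialOrthogonalGroup_iff, Matrix.mem_orthogonalGroup_iff]
  generalize (a : ℍ[ℝ]) = q at h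
  obtain ⟨w, x, y, z⟩ := q
  simp only at h
  -- With N the squared norm, the rows of the matrix have squared length N² and its determinant is
  -- N³; the coefficients below are the cofactors of N - 1 in N² - 1 and N³ - 1.
  constructor
  · ext i j
    fin_cases i <;> fin_cases j <;>
      simp [rotMatrix, Matrix.mul_apply, Fin.sum_univ_three] <;>
      first | ring1 | linear_combination (w ^ 2 + x ^ 2 + y ^ 2 + z ^ 2 + 1) * h
  · simp [rotMatrix, Matrix.det_fin_three]
    linear_combination
      ((w ^ 2 + x ^ 2 + y ^ 2 + z ^ 2) ^ 2 + (w ^ 2 + x ^ 2 + y ^ 2 + z ^ 2) + 1) * h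

/-- The double covering of `SO(3)` by the unit quaternions. -/
def spin : UnitQuaternion →* SO3 where
  toFun a := ⟨rotMatrix a, rotMatrix_mem a⟩
  map_one' := Subtype.ext rotMatrix_one
  map_mul' a b := Subtype.ext (rotMatrix_mul a b)

theorem continuous_spin : Continuous spin :=
  (continuous_rotMatrix.comp continuous_subtype_val).subtype_mk _

theorem spin_eq_one_iff (a : UnitQuaternion) : spin a = 1 ↔ a = 1 ∨ a = -1 := by
  constructor
  · intro h
    have h' : rotMatrix a = 1 := congrArg Subtype.val h
    have hs := a.sum_sq
    have h₀ := congrFun (congrFun h' 0) 0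
    have h₁ := congrFun (congrFun h' 1) 1
    have h₂ := congrFun (congrFun h' 2) 2
    simp [rotMatrix] at h₀ h₁ h₂
    have hx : (a : ℍ[ℝ]).imI = 0 := by
      apply pow_eq_zero_iff two_ne_zero |>.1; nlinarith
    have hy : (a : ℍ[ℝ]).imJ = 0 := by
      apply pow_eq_zero_iff two_ne_zero |>.1; nlinarith
    have hz : (a : ℍ[ℝ]).imK = 0 := by
      apply pow_eq_zero_iff two_ne_zero |>.1; nlinarith
    rw [hx, hy, hz] at hs
    have hw : (a : ℍ[ℝ]).re ^ 2 = 1 := by linarith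
    rcases eq_or_eq_neg_of_sq_eq_sq (a : ℍ[ℝ]).re 1 (by rw [hw, one_pow]) with hw | hw
    · left
      apply Subtype.ext
      ext <;> simp [hw, hx, hy, hz]
    · right
      apply Subtype.ext
      ext <;> simp [hw, hx, hy, hz]
  · rintro (rfl | rfl)
    · exact map_one _
    · apply Subtype.ext
      ext i j
      fin_cases i <;> fin_cases j <;> simp [spin, rotMatrix]

/-- For the rotation of a unit quaternion with real part w and imaginary part u, one has 1 + tr =
4w², and the antisymmetric part of the matrix determines 4wu. So the quaternion is recovered by
normalizing the vector 4w(w, u), as long as w ≠ 0, that is, unless the rotation has angle π. -/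
theorem mem_range_spin_of_trace_ne (R : SO3) (hR : 1 + R.1.trace ≠ 0) : ∃ a, spin a = R := by
  obtain ⟨R, hm⟩ := R
  rw [Matrix.mem_specialOrthogonalGroup_iff, Matrix.mem_orthogonalGroup_iff'] at hm
  obtain ⟨ho, hd⟩ := hm
  -- As the determinant is 1, every entry equals its own cofactor. These quadratic relations, with
  -- the orthonormality of the columns, are what the `grind` calls below rest on.
  have hadj : R.adjugate = R.transpose := by
    have h1 : R.transpose * R = 1 := ho
    calc R.adjugate = R.transpose * R * R.adjugate := by rw [h1, one_mul]
      _ = R.transpose := by rw [mul_assoc, Matrix.mul_adjugate, hd, one_smul, mul_one]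
  have htr : R.trace = R 0 0 + R 1 1 + R 2 2 := Matrix.trace_fin_three R
  have ho' : ∀ i j, R 0 i * R 0 j + R 1 i * R 1 j + R 2 i * R 2 j =
      (1 : Matrix (Fin 3) (Fin 3) ℝ) i j := fun i j => by
    rw [← ho, Matrix.mul_apply, Fin.sum_univ_three]; rfl
  have o₁ := ho' 0 0
  have o₂ := ho' 1 1
  have o₃ := ho' 2 2
  have o₄ := ho' 0 1
  have o₅ := ho' 0 2
  have o₆ := ho' 1 2
  have hadj' : ∀ i j, R.adjugate i j = R j i := fun i j => by rw [hadj]; rfl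
  rw [Matrix.adjugate_fin_three] at hadj'
  have a₁ := hadj' 0 0
  have a₂ := hadj' 0 1
  have a₃ := hadj' 0 2
  have a₄ := hadj' 1 0
  have a₅ := hadj' 1 1
  have a₆ := hadj' 1 2
  have a₇ := hadj' 2 0
  have a₈ := hadj' 2 1
  have a₉ := hadj' 2 2
  simp at o₁ o₂ o₃ o₄ o₅ o₆ a₁ a₂ a₃ a₄ a₅ a₆ a₇ a₈ a₉
  replace hR : 1 + (R 0 0 + R 1 1 + R 2 2) ≠ 0 := htr ▸ hR
  clear hadj hadj' ho ho' htr hd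
  generalize hRa : R 0 0 = a at *
  generalize hRb : R 0 1 = b at *
  generalize hRc : R 0 2 = c at *
  generalize hRd : R 1 0 = d at *
  generalize hRe : R 1 1 = e at *
  generalize hRf : R 1 2 = f at *
  generalize hRg : R 2 0 = g at *
  generalize hRh : R 2 1 = h at *
  generalize hRi : R 2 2 = i at *
  -- The squared norm of 4w(w, u) is 16w² = 4(1 + tr), so `r` below is the inverse of the norm.
  have hN : (1 + a + e + i) ^ 2 + (h - f) ^ 2 + (c - g) ^ 2 + (d - b) ^ 2 =
      4 * (1 + a + e + i) := by grind
  have hpos : 0 < 4 * (1 + a + e + i) := by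
    refine lt_of_le_of_ne (hN ▸ by positivity) fun h0 => hR (by linarith)
  obtain ⟨r, hr⟩ : ∃ r : ℝ, r ^ 2 * (4 * (1 + a + e + i)) = 1 :=
    ⟨(√(4 * (1 + a + e + i)))⁻¹, by
      rw [inv_pow, Real.sq_sqrt hpos.le, inv_mul_cancel₀ hpos.ne']⟩
  refine ⟨UnitQuaternion.mk (r * (1 + a + e + i)) (r * (h - f)) (r * (c - g)) (r * (d - b))
    (by linear_combination r ^ 2 * hN + hr), Subtype.ext ?_⟩
  have e₁ : (1 + a + e + i) ^ 2 + (h - f) ^ 2 - (c - g) ^ 2 - (d - b) ^ 2 =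
      4 * (1 + a + e + i) * a := by grind
  have e₂ : 2 * ((h - f) * (c - g) - (1 + a + e + i) * (d - b)) = 4 * (1 + a + e + i) * b := by
    grind
  have e₃ : 2 * ((h - f) * (d - b) + (1 + a + e + i) * (c - g)) = 4 * (1 + a + e + i) * c := by
    grind
  have e₄ : 2 * ((h - f) * (c - g) + (1 + a + e + i) * (d - b)) = 4 * (1 + a + e + i) * d := by
    grind
  have e₅ : (1 + a + e + i) ^ 2 - (h - f) ^ 2 + (c - g) ^ 2 - (d - b) ^ 2 =
      4 * (1 + a + e + i) * e := by grind
  have e₆ : 2 * ((c - g) * (d - b) - (1 + a + e + i) * (h - f)) = 4 * (1 + a + e + i) * f := by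
    grind
  have e₇ : 2 * ((h - f) * (d - b) - (1 + a + e + i) * (c - g)) = 4 * (1 + a + e + i) * g := by
    grind
  have e₈ : 2 * ((c - g) * (d - b) + (1 + a + e + i) * (h - f)) = 4 * (1 + a + e + i) * h := by
    grind
  have e₉ : (1 + a + e + i) ^ 2 - (h - f) ^ 2 - (c - g) ^ 2 + (d - b) ^ 2 =
      4 * (1 + a + e + i) * i := by grind
  ext k l
  fin_cases k <;> fin_cases l <;>
    simp [spin, rotMatrix, UnitQuaternion.mk, hRa, hRb, hRc, hRd, hRe, hRf, hRg, hRh, hRi]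
  · linear_combination r ^ 2 * e₁ + a * hr
  · linear_combination r ^ 2 * e₂ + b * hr
  · linear_combination r ^ 2 * e₃ + c * hr
  · linear_combination r ^ 2 * e₄ + d * hr
  · linear_combination r ^ 2 * e₅ + e * hr
  · linear_combination r ^ 2 * e₆ + f * hr
  · linear_combination r ^ 2 * e₇ + g * hr
  · linear_combination r ^ 2 * e₈ + h * hr
  · linear_combination r ^ 2 * e₉ + i * hr

namespace UnitQuaternion

/-- The quaternion unit `i`. -/
def unitI : UnitQuaternion := mk 0 1 0 0 (by norm_num)

/-- The quaternion unit `j`. -/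
def unitJ : UnitQuaternion := mk 0 0 1 0 (by norm_num)

/-- The quaternion unit `k`. -/
def unitK : UnitQuaternion := mk 0 0 0 1 (by norm_num)

end UnitQuaternion

open UnitQuaternion

theorem spin_unitI : spin unitI = kleinX₁ := by
  apply Subtype.ext
  ext i j
  fin_cases i <;> fin_cases j <;> simp [spin, rotMatrix, unitI, mk, kleinX₁, diagSO3]

theorem spin_unitJ : spin unitJ = kleinX₂ := by
  apply Subtype.ext
  ext i j
  fin_cases i <;> fin_cases j <;> simp [spin, rotMatrix, unitJ, mk, kleinX₂, diagSO3]

theorem spin_unitK : spin unitK = kleinX₃ := by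
  apply Subtype.ext
  ext i j
  fin_cases i <;> fin_cases j <;> simp [spin, rotMatrix, unitK, mk, kleinX₃, diagSO3]

/-- Since 1 + x₁ + x₂ + x₃ = 0 as matrices, the four numbers 1 + tr(xR), for x in V₄, add up to 4.
One of them is non-zero, and the trace criterion applies to the corresponding xR. -/
theorem spin_surjective : Function.Surjective spin := by
  intro R
  have key : ∀ b : UnitQuaternion, 1 + (spin b * R).1.trace ≠ 0 → ∃ a, spin a = R := by
    intro b hb
    obtain ⟨a, ha⟩ := mem_range_spin_of_trace_ne _ hb
    exact ⟨b⁻¹ * a, by rw [map_mul, ha, map_inv, inv_mul_cancel_left]⟩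
  by_contra hR
  have h₀ := not_not.1 fun h => hR (key 1 h)
  have h₁ := not_not.1 fun h => hR (key unitI h)
  have h₂ := not_not.1 fun h => hR (key unitJ h)
  have h₃ := not_not.1 fun h => hR (key unitK h)
  simp only [map_one, one_mul, spin_unitI, spin_unitJ, spin_unitK, Submonoid.coe_mul,
    kleinX₁, kleinX₂, kleinX₃, diagSO3, Matrix.trace_fin_three, Matrix.diagonal_mul] at h₀ h₁ h₂ h₃
  simp at h₀ h₁ h₂ h₃
  linarith

theorem spin_eq_iff (a b : UnitQuaternion) : spin a = spin b ↔ a = b ∨ a = -b := by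
  have : spin a = spin b ↔ spin (a * b⁻¹) = 1 := by
    rw [map_mul, map_inv, mul_inv_eq_one]
  rw [this, spin_eq_one_iff, mul_inv_eq_iff_eq_mul, mul_inv_eq_iff_eq_mul, one_mul,
    neg_mul, one_mul]

theorem isCoveringMap_spin : IsCoveringMap spin := by
  have hq : Topology.IsQuotientMap spin :=
    continuous_spin.isClosedMap.isQuotientMap continuous_spin spin_surjective
  refine (hq.isQuotientCoveringMap_of_isDiscrete_ker_monoidHom ?_).isCoveringMap
  refine Set.Finite.isDiscrete (Set.Finite.subset (Set.toFinite {1, -1}) fun a ha => ?_)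
  exact (spin_eq_one_iff a).1 ha

end

noncomputable section

open Quaternion

/-! ### Faces of the standard simplex -/

theorem simpFace_succAbove (n : ℕ) (i : Fin (n + 2)) (t : Simp n) (k : Fin (n + 1)) :
    (simpFace n i t) (i.succAbove k) = t k := by
  simp [simpFace, FunOnFinite.linearMap_apply_apply]
  rw [Finset.sum_filter, Finset.sum_ite_eq' Finset.univ k, if_pos (Finset.mem_univ k)]

theorem simpFace_self (n : ℕ) (i : Fin (n + 2)) (t : Simp n) : (simpFace n i t) i = 0 := by
  simp [simpFace, FunOnFinite.linearMap_apply_apply, Fin.succAbove_ne]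

theorem simpFace_vertex (n : ℕ) (i : Fin (n + 2)) (k : Fin (n + 1)) :
    simpFace n i (stdSimplex.vertex k) = stdSimplex.vertex (i.succAbove k) :=
  stdSimplex.map_vertex _ _

theorem simpFace_injective (n : ℕ) (i : Fin (n + 2)) : Function.Injective (simpFace n i) := by
  intro s t h
  apply stdSimplex.ext
  funext k
  rw [← simpFace_succAbove n i s, h, simpFace_succAbove]

theorem eq_vertex_zero_of_apply_one {s : Simp 1} (h : s 1 = 0) : s = stdSimplex.vertex 0 := by
  have := stdSimplex.add_eq_one s
  apply stdSimplex.ext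
  funext k
  fin_cases k
  · simp; linarith
  · simp [h]

theorem eq_vertex_one_of_apply_zero {s : Simp 1} (h : s 0 = 0) : s = stdSimplex.vertex 1 := by
  have := stdSimplex.add_eq_one s
  apply stdSimplex.ext
  funext k
  fin_cases k
  · simp [h]
  · simp; linarith

/-! ### Extension of maps to the unit quaternions over low-dimensional spaces -/

/-- Extend to ℍ by Tietze, then push off the origin: a smooth map from a 3-dimensional space to a
4-dimensional one omits values arbitrarily close to 0. Blending this perturbation with the original
extension keeps the values on `B`, and normalizing ends in the sphere. -/
theorem exists_extension_unitQuaternion {B : Set (Fin 3 → ℝ)} (hB : IsClosed B)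
    (f : C(B, UnitQuaternion)) :
    ∃ g : C(Fin 3 → ℝ, UnitQuaternion), ∀ b : B, g b = f b := by
  have : FiniteDimensional ℝ ℍ[ℝ] :=
    Module.finite_of_finrank_pos (by rw [Quaternion.finrank_eq_four]; norm_num)
  have : TietzeExtension ℍ[ℝ] := TietzeExtension.of_tvs ℝ
  obtain ⟨g₀, hg₀⟩ := ContinuousMap.exists_restrict_eq hB
    ((⟨Subtype.val, continuous_subtype_val⟩ : C(UnitQuaternion, ℍ[ℝ])).comp f)
  have hg₀' : ∀ b : B, g₀ b = (f b : ℍ[ℝ]) := fun b => DFunLike.congr_fun hg₀ b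
  obtain ⟨g₁, hg₁, hd, -⟩ := g₀.continuous.exists_contDiff_approx 1
    (continuous_const (y := (1 / 4 : ℝ))) (by intro; norm_num)
  have hdense := ContDiff.dense_compl_range_of_finrank_lt_finrank hg₁
    (by rw [Quaternion.finrank_eq_four]; simp)
  obtain ⟨v, hv, hvr⟩ := hdense.exists_dist_lt 0 (show (0 : ℝ) < 1 / 4 by norm_num)
  rw [dist_zero_left] at hvr
  have hne : ∀ x, g₁ x - v ≠ 0 := fun x hx => hv ⟨x, sub_eq_zero.1 hx⟩
  have hclose : ∀ x, ‖g₁ x - v - g₀ x‖ < 1 / 2 := fun x => by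
    have h₁ := hd x
    rw [dist_eq_norm] at h₁
    calc ‖g₁ x - v - g₀ x‖ = ‖(g₁ x - g₀ x) - v‖ := by congr 1; abel
      _ ≤ ‖g₁ x - g₀ x‖ + ‖v‖ := norm_sub_le _ _
      _ < 1 / 2 := by linarith
  -- The cutoff is 0 where ‖g₀‖ ≤ 3/4 and 1 where ‖g₀‖ ≥ 1, in particular on `B`. Where it is
  -- positive, `G` stays within 1/2 of `g₀` and cannot vanish.
  let χ : (Fin 3 → ℝ) → ℝ := fun x => max 0 (min 1 (4 * ‖g₀ x‖ - 3))
  have hχ : Continuous χ := by fun_prop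
  have hχ0 : ∀ x, 0 ≤ χ x := fun x => le_max_left _ _
  have hχ1 : ∀ x, χ x ≤ 1 := fun x => max_le zero_le_one (min_le_left _ _)
  let G : (Fin 3 → ℝ) → ℍ[ℝ] := fun x => (g₁ x - v) + χ x • (g₀ x - (g₁ x - v))
  have hG : Continuous G := by
    have := hg₁.continuous
    fun_prop
  have hG0 : ∀ x, G x ≠ 0 := by
    intro x hx
    by_cases h : ‖g₀ x‖ ≤ 3 / 4
    · have : χ x = 0 := max_eq_left ((min_le_right _ _).trans (by linarith))
      apply hne x
      simpa [G, this] using hx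
    · have h₁ : g₀ x = -((1 - χ x) • (g₁ x - v - g₀ x)) := by
        rw [eq_neg_iff_add_eq_zero, ← hx]
        simp only [G]
        module
      have h₂ : ‖g₀ x‖ ≤ 1 / 2 := by
        rw [h₁, norm_neg, norm_smul, Real.norm_of_nonneg (by linarith [hχ1 x])]
        nlinarith [hχ0 x, hχ1 x, hclose x, norm_nonneg (g₁ x - v - g₀ x)]
      linarith
  refine ⟨⟨fun x => ⟨‖G x‖⁻¹ • G x, ?_⟩, ?_⟩, fun b => Subtype.ext ?_⟩
  · rw [mem_sphere_zero_iff_norm, norm_smul, norm_inv, norm_norm,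
      inv_mul_cancel₀ (norm_ne_zero_iff.2 (hG0 x))]
  · exact ((hG.norm.inv₀ fun x => norm_ne_zero_iff.2 (hG0 x)).smul hG).subtype_mk _
  · have hn : ‖g₀ b‖ = 1 := by rw [hg₀']; exact norm_eq_of_mem_sphere _
    have hc : χ b = 1 := by simp only [χ, hn]; norm_num
    have hGb : G b = f b := by simp [G, hc, hg₀']
    change ‖G b‖⁻¹ • G b = f b
    rw [hGb, norm_eq_of_mem_sphere, inv_one, one_smul]

/-- The 3-sphere is simply connected: three paths that form a triangle bound a 2-simplex. -/
theorem exists_simplex_unitQuaternion (e : Fin 3 → C(Simp 1, UnitQuaternion))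
    (h₀ : e 2 (stdSimplex.vertex 0) = e 1 (stdSimplex.vertex 0))
    (h₁ : e 2 (stdSimplex.vertex 1) = e 0 (stdSimplex.vertex 0))
    (h₂ : e 1 (stdSimplex.vertex 1) = e 0 (stdSimplex.vertex 1)) :
    ∃ τ : C(Simp 2, UnitQuaternion), ∀ i, τ.comp (simpFace 1 i) = e i := by
  -- The boundary of the triangle is a quotient of three disjoint edges, so the given paths descend
  -- to it. It is compact in ℝ³, and the extension theorem applies to the descended map.
  let F : Fin 3 × Simp 1 → (Fin 3 → ℝ) := fun u => (simpFace 1 u.1 u.2).1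
  have hF : Continuous F := by
    refine continuous_prod_of_discrete_left.2 fun i => ?_
    exact continuous_subtype_val.comp (simpFace 1 i).continuous
  have hF' : Continuous (Set.rangeFactorization F) := hF.subtype_mk _
  let F' : C(Fin 3 × Simp 1, Set.range F) := ⟨Set.rangeFactorization F, hF'⟩
  have hq : Topology.IsQuotientMap F' :=
    hF'.isClosedMap.isQuotientMap hF' Set.rangeFactorization_surjective
  let g : C(Fin 3 × Simp 1, UnitQuaternion) :=
    ⟨fun u => e u.1 u.2, continuous_prod_of_discrete_left.2 fun i => (e i).continuous⟩
  have hg : Function.FactorsThrough g F' := by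
    rintro ⟨i, s⟩ ⟨j, t⟩ huv
    have huv' : simpFace 1 i s = simpFace 1 j t := 
      Subtype.ext (congrArg (fun y => y.1) huv)
    change e i s = e j t
    by_cases hij : i = j
    · subst hij
      rw [simpFace_injective 1 i huv']
    · obtain ⟨k, hk⟩ := Fin.exists_succAbove_eq (Ne.symm hij)
      obtain ⟨l, hl⟩ := Fin.exists_succAbove_eq hij
      -- A point common to two different faces is their common vertex, where the hypotheses `h₀`,
      -- `h₁`, `h₂` apply.
      have hs : s k = 0 := by
        rw [← simpFace_succAbove 1 i s, huv', hk, simpFace_self]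
      have ht : t l = 0 := by
        rw [← simpFace_succAbove 1 j t, ← huv', hl, simpFace_self]
      fin_cases i <;> fin_cases j <;> fin_cases k <;> fin_cases l <;>
        first
        | exact absurd rfl hij
        | exact absurd hk (by decide)
        | exact absurd hl (by decide)
        | (simp only [Fin.zero_eta, Fin.mk_one, Fin.reduceFinMk] at *
           first
           | rw [eq_vertex_zero_of_apply_one hs]
           | rw [eq_vertex_one_of_apply_zero hs]
           first
           | rw [eq_vertex_zero_of_apply_one ht]
           | rw [eq_vertex_one_of_apply_zero ht]
           simp only [h₀, h₁, h₂])
  obtain ⟨G, hG⟩ := exists_extension_unitQuaternion (isCompact_range hF).isClosed (hq.lift g hg)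
  refine ⟨G.comp ⟨Subtype.val, continuous_subtype_val⟩, fun i => ?_⟩
  ext1 t
  have := hG (Set.rangeFactorization F (i, t))
  have h' := DFunLike.congr_fun (hq.lift_comp g hg) (i, t)
  exact this.trans h'

end

noncomputable section

open Topology

/-! ### Lifting simplices through covering maps -/

/-- The straight-line contraction of the simplex to its vertex `0`. -/
def simpContract (n : ℕ) : C(unitInterval × Simp n, Simp n) :=
  ⟨fun u => ⟨(1 - (u.1 : ℝ)) • (stdSimplex.vertex (S := ℝ) (0 : Fin (n + 1))).1 +
      (u.1 : ℝ) • u.2.1,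
    convex_stdSimplex ℝ _ (stdSimplex.vertex (S := ℝ) (0 : Fin (n + 1))).2 u.2.2
      (sub_nonneg.2 u.1.2.2) u.1.2.1 (by ring)⟩,
    Continuous.subtype_mk (by fun_prop) _⟩

theorem simpContract_zero {n : ℕ} (t : Simp n) :
    simpContract n (0, t) = stdSimplex.vertex 0 := by
  apply Subtype.ext; simp [simpContract]

theorem simpContract_one {n : ℕ} (t : Simp n) : simpContract n (1, t) = t := by
  apply Subtype.ext; simp [simpContract]

theorem simpContract_vertex {n : ℕ} (s : unitInterval) :
    simpContract n (s, stdSimplex.vertex 0) = stdSimplex.vertex 0 := by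
  apply Subtype.ext
  simp only [simpContract, ContinuousMap.coe_mk]
  rw [← add_smul]; simp

section

variable {E X : Type*} [TopologicalSpace E] [TopologicalSpace X] {p : E → X}

/-- The contraction to vertex 0 is a homotopy from a constant map to `σ`; lifting it from the
constant map at `e` gives the lift at time 1. -/
theorem IsCoveringMap.exists_lift_simplex (hp : IsCoveringMap p) {n : ℕ} (σ : C(Simp n, X))
    (e : E) (he : p e = σ (stdSimplex.vertex 0)) :
    ∃ τ : C(Simp n, E), (∀ t, p (τ t) = σ t) ∧ τ (stdSimplex.vertex 0) = e := by
  have h0 : ∀ t, (σ.comp (simpContract n)) (0, t) = p ((ContinuousMap.const (Simp n) e) t) :=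
    fun t => by simp [simpContract_zero, he]
  let H := hp.liftHomotopy (σ.comp (simpContract n)) (ContinuousMap.const _ e) h0
  have hH : ∀ u, p (H u) = σ (simpContract n u) := fun u =>
    congrFun (hp.liftHomotopy_lifts (σ.comp (simpContract n)) (ContinuousMap.const _ e) h0) u
  refine ⟨H.comp ⟨fun t => (1, t), by fun_prop⟩, fun t => ?_, ?_⟩
  · exact (hH _).trans (congrArg σ (simpContract_one t))
  -- The contraction fixes vertex 0, so the lifted track of this vertex lies in one fibre and is
  -- constant.
  · have hc : Continuous fun s : unitInterval => H (s, stdSimplex.vertex 0) := by fun_prop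
    have := hp.const_of_comp hc (fun a a' => by
      simp only [hH, simpContract_vertex]) 1 0
    exact this.trans (hp.liftHomotopy_zero (σ.comp (simpContract n)) (ContinuousMap.const _ e) h0 _)

theorem IsCoveringMap.lift_simplex_unique (hp : IsCoveringMap p) {n : ℕ} {τ τ' : C(Simp n, E)}
    (h : ∀ t, p (τ t) = p (τ' t)) (i : Fin (n + 1))
    (h0 : τ (stdSimplex.vertex i) = τ' (stdSimplex.vertex i)) : τ = τ' :=
  DFunLike.coe_injective
    (hp.eq_of_comp_eq τ.continuous τ'.continuous (funext h) _ h0)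

end

/-! ### The universal covering of the torus -/

/-- The plane, universal covering of the torus. -/
abbrev Plane : Type := ℝ × ℝ

/-- The universal covering homomorphism of the torus. -/
def torusProj : Plane →+ Torus :=
  AddMonoidHom.prodMap (QuotientAddGroup.mk' _) (QuotientAddGroup.mk' _)

theorem torusProj_apply (x : Plane) :
    torusProj x = ((x.1 : UnitAddCircle), (x.2 : UnitAddCircle)) := rfl

theorem torusProj_eq_zero_iff {x : Plane} :
    torusProj x = 0 ↔ ∃ m n : ℤ, x = ((m : ℝ), (n : ℝ)) := by
  rw [torusProj_apply, Prod.mk_eq_zero, AddCircle.coe_eq_zero_iff, AddCircle.coe_eq_zero_iff]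
  constructor
  · rintro ⟨⟨m, hm⟩, n, hn⟩
    exact ⟨m, n, Prod.ext (by simp [← hm]) (by simp [← hn])⟩
  · rintro ⟨m, n, rfl⟩
    exact ⟨⟨m, by simp⟩, n, by simp⟩

theorem isOpenQuotientMap_torusProj : IsOpenQuotientMap torusProj :=
  IsOpenQuotientMap.prodMap QuotientAddGroup.isOpenQuotientMap_mk
    QuotientAddGroup.isOpenQuotientMap_mk

theorem isCoveringMap_torusProj : IsCoveringMap torusProj := by
  refine (isOpenQuotientMap_torusProj.isQuotientMap.isAddQuotientCoveringMap_of_isDiscrete_ker_addMonoidHom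
    ?_).isCoveringMap
  refine ⟨DiscreteTopology.of_forall_le_dist zero_lt_one ?_⟩
  rintro ⟨x, hx⟩ ⟨y, hy⟩ hxy
  obtain ⟨m, n, rfl⟩ := torusProj_eq_zero_iff.1 hx
  obtain ⟨m', n', rfl⟩ := torusProj_eq_zero_iff.1 hy
  rw [Subtype.dist_eq, Prod.dist_eq]
  simp only [Int.dist_cast_real]
  by_cases h : m = m'
  · have h' : n ≠ n' := fun h' => hxy (by subst h h'; rfl)
    exact le_max_of_le_right (Int.pairwise_one_le_dist h')
  · exact le_max_of_le_left (Int.pairwise_one_le_dist h)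

theorem continuous_torusProj : Continuous torusProj := isOpenQuotientMap_torusProj.continuous

theorem torusProj_surjective : Function.Surjective torusProj :=
  isOpenQuotientMap_torusProj.surjective

/-! ### Singular cochains modulo 2 -/

section

variable {X : Type*} [TopologicalSpace X]

theorem zsmul_neg_one_pow_zmod_two (k : ℕ) (x : ZMod 2) : (-1 : ℤ) ^ k • x = x := by
  rcases neg_one_pow_eq_or ℤ k with h | h <;> rw [h]
  · exact one_smul _ _
  · rw [neg_one_zsmul, ZMod.neg_eq_self_mod_two]

theorem singularCoboundary_apply_mod_two {n : ℕ} (f : SingularCochain X (ZMod 2) n)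
    (σ : C(Simp (n + 1), X)) :
    singularCoboundary X (ZMod 2) n f σ = ∑ i : Fin (n + 2), f (σ.comp (simpFace n i)) := by
  simp only [singularCoboundary, AddMonoidHom.coe_mk, ZeroHom.coe_mk, zsmul_neg_one_pow_zmod_two]

theorem singularCoboundary_one_apply (f : SingularCochain X (ZMod 2) 1) (σ : C(Simp 2, X)) :
    singularCoboundary X (ZMod 2) 1 f σ = f (σ.comp (simpFace 1 0)) + f (σ.comp (simpFace 1 1)) +
      f (σ.comp (simpFace 1 2)) :=
  (singularCoboundary_apply_mod_two f σ).trans (Fin.sum_univ_three _)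

theorem singularCoboundary_two_apply (f : SingularCochain X (ZMod 2) 2) (σ : C(Simp 3, X)) :
    singularCoboundary X (ZMod 2) 2 f σ = f (σ.comp (simpFace 2 0)) + f (σ.comp (simpFace 2 1)) +
      f (σ.comp (simpFace 2 2)) + f (σ.comp (simpFace 2 3)) :=
  (singularCoboundary_apply_mod_two f σ).trans (Fin.sum_univ_four _)

theorem Fin.castSucc_succAbove_succAbove {n : ℕ} {i j : Fin (n + 1)} (h : i ≤ j) (k : Fin n) :
    i.castSucc.succAbove (j.succAbove k) = j.succ.succAbove (i.succAbove k) := by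
  rw [Fin.le_def] at h
  simp only [Fin.ext_iff, Fin.succAbove, Fin.lt_def]
  split_ifs <;> simp only [Fin.val_castSucc, Fin.val_succ] at * <;> omega

theorem simpFace_comp_simpFace (n : ℕ) {i j : Fin (n + 2)} (h : i ≤ j) :
    (simpFace (n + 1) i.castSucc).comp (simpFace n j) =
      (simpFace (n + 1) j.succ).comp (simpFace n i) := by
  ext1 t
  simp only [simpFace, ContinuousMap.comp_apply, ContinuousMap.coe_mk, stdSimplex.map_comp_apply]
  congr 1
  funext k
  exact Fin.castSucc_succAbove_succAbove h k

theorem singularCoboundary_singularCoboundary (f : SingularCochain X (ZMod 2) 1) :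
    singularCoboundary X (ZMod 2) 2 (singularCoboundary X (ZMod 2) 1 f) = 0 := by
  funext σ
  have key : ∀ {i j : Fin 3}, i ≤ j → (σ.comp (simpFace 2 i.castSucc)).comp (simpFace 1 j) =
      (σ.comp (simpFace 2 j.succ)).comp (simpFace 1 i) := fun h => by
    rw [ContinuousMap.comp_assoc, simpFace_comp_simpFace 1 h, ContinuousMap.comp_assoc]
  have h₀₀ := key (le_refl (0 : Fin 3))
  have h₀₁ := key (show (0 : Fin 3) ≤ 1 by decide)
  have h₀₂ := key (show (0 : Fin 3) ≤ 2 by decide)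
  have h₁₁ := key (le_refl (1 : Fin 3))
  have h₁₂ := key (show (1 : Fin 3) ≤ 2 by decide)
  have h₂₂ := key (le_refl (2 : Fin 3))
  simp only [Fin.castSucc_zero, Fin.succ_zero_eq_one, Fin.succ_one_eq_two, Fin.castSucc_one,
    Fin.reduceSucc, Fin.reduceCastSucc] at h₀₀ h₀₁ h₀₂ h₁₁ h₁₂ h₂₂
  rw [singularCoboundary_two_apply]
  simp only [singularCoboundary_one_apply]
  rw [h₀₀, h₀₁, h₀₂, h₁₁, h₁₂, h₂₂]
  simp only [Pi.zero_apply]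
  grind

end

end

noncomputable section

open Topology

/-! ### The fundamental group of the torus -/

/-- The lattice `ℤ²` in the plane. -/
def latticeVec (n : ℤ × ℤ) : Plane := ((n.1 : ℝ), (n.2 : ℝ))

theorem latticeVec_add (m n : ℤ × ℤ) : latticeVec (m + n) = latticeVec m + latticeVec n := by
  simp [latticeVec]

theorem latticeVec_zero : latticeVec 0 = 0 := by simp [latticeVec, Prod.zero_eq_mk]

theorem latticeVec_neg (n : ℤ × ℤ) : latticeVec (-n) = -latticeVec n := by simp [latticeVec]

theorem torusProj_latticeVec (n : ℤ × ℤ) : torusProj (latticeVec n) = 0 :=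
  torusProj_eq_zero_iff.2 ⟨n.1, n.2, rfl⟩

theorem torusProj_add_latticeVec (x : Plane) (n : ℤ × ℤ) :
    torusProj (x + latticeVec n) = torusProj x := by
  rw [map_add, torusProj_latticeVec, add_zero]

theorem exists_latticeVec_of_torusProj_eq {x y : Plane} (h : torusProj x = torusProj y) :
    ∃ n, x = y + latticeVec n := by
  obtain ⟨m, n, hmn⟩ := torusProj_eq_zero_iff.1 (show torusProj (x - y) = 0 by
    rw [map_sub, h, sub_self])
  exact ⟨(m, n), by rw [← sub_eq_iff_eq_add']; exact hmn⟩

/-- The straight path between two points of the plane. -/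
def planeSegment (x y : Plane) : Path x y where
  toFun s := x + (s : ℝ) • (y - x)
  continuous_toFun := by fun_prop
  source' := by simp
  target' := by simp

/-- The class of the loop that is the image of the segment from `y₀` to `y₀ + n`. -/
def latticeLoop (y₀ : Plane) (n : ℤ × ℤ) : FundamentalGroup Torus (torusProj y₀) :=
  FundamentalGroup.fromPath (Path.Homotopic.Quotient.mk
    (((planeSegment y₀ (y₀ + latticeVec n)).map continuous_torusProj).cast rfl
      (torusProj_add_latticeVec y₀ n).symm))

/-- The plane is simply connected, so the end point of a lift determines the class of a loop. All
identities between loops below reduce to this one. -/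
theorem fromPath_mk_eq_latticeLoop {y₀ z : Plane} (γ : Path (torusProj y₀) (torusProj y₀))
    (Γ : Path y₀ z) (n : ℤ × ℤ) (hz : z = y₀ + latticeVec n)
    (h : ∀ s, torusProj (Γ s) = γ s) :
    FundamentalGroup.fromPath (Path.Homotopic.Quotient.mk γ) = latticeLoop y₀ n := by
  subst hz
  have hγ : γ = (Γ.map continuous_torusProj).cast rfl (torusProj_add_latticeVec y₀ n).symm := by
    ext1
    funext s
    exact (h s).symm
  have hh : Γ.Homotopic (planeSegment y₀ (y₀ + latticeVec n)) :=
    SimplyConnectedSpace.paths_homotopic _ _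
  rw [hγ]
  exact Quotient.sound (hh.map ⟨torusProj, continuous_torusProj⟩)

/-- Translation of a path in the plane. -/
def Path.translate {x y : Plane} (Γ : Path x y) (v : Plane) : Path (x + v) (y + v) :=
  Γ.map (f := fun z => z + v) (by fun_prop)

theorem latticeLoop_add (y₀ : Plane) (m n : ℤ × ℤ) :
    latticeLoop y₀ (m + n) = latticeLoop y₀ m * latticeLoop y₀ n := by
  symm
  -- The product in `FundamentalGroup` runs its right factor first, so the segment for `n` precedes
  -- the translated segment for `m`.
  refine fromPath_mk_eq_latticeLoop _
    ((planeSegment y₀ (y₀ + latticeVec n)).trans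
      ((planeSegment y₀ (y₀ + latticeVec m)).translate (latticeVec n))) (m + n) ?_ ?_
  · rw [latticeVec_add, add_assoc]
  · intro s
    simp only [Path.trans_apply]
    split_ifs
    · rfl
    · exact torusProj_add_latticeVec _ _

/-- The homomorphism `ℤ² → π₁(T²)` given by the images of segments. -/
def latticeHom (y₀ : Plane) : Multiplicative (ℤ × ℤ) →* FundamentalGroup Torus (torusProj y₀) :=
  MonoidHom.mk' (fun n => latticeLoop y₀ n.toAdd) fun m n => latticeLoop_add y₀ m.toAdd n.toAdd

/-- Every loop lifts to a path that ends at a lattice translate of `y₀`. Injectivity is not needed: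
surjectivity of a representation can be tested after composition with this map. -/
theorem latticeHom_surjective (y₀ : Plane) : Function.Surjective (latticeHom y₀) := by
  intro a
  induction a using Quotient.inductionOn with
  | h γ =>
    let Γ := isCoveringMap_torusProj.liftPath γ.toContinuousMap y₀ γ.source
    have hΓ : ∀ s, torusProj (Γ s) = γ s :=
      congrFun (isCoveringMap_torusProj.liftPath_lifts γ.toContinuousMap y₀ γ.source)
    have h0 : Γ 0 = y₀ := isCoveringMap_torusProj.liftPath_zero γ.toContinuousMap y₀ γ.source
    obtain ⟨n, hn⟩ := exists_latticeVec_of_torusProj_eq (x := Γ 1) (y := y₀)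
      ((hΓ 1).trans γ.target)
    exact ⟨Multiplicative.ofAdd n,
      (fromPath_mk_eq_latticeLoop γ ⟨Γ, h0, rfl⟩ n hn hΓ).symm⟩

/-! ### Development of paths in the torus -/

section Development

variable (y₀ : Plane)

/-- Evaluation of the paths in the torus that start at a given point. -/
def pathsEval : C(unitInterval × PathsFrom (torusProj y₀), Torus) :=
  ⟨fun u => u.2.1 u.1,
    (continuous_eval (F := C(unitInterval, Torus))).comp
      ((continuous_subtype_val.comp continuous_snd).prodMk continuous_fst)⟩

/-- The lifts to the plane, starting at `y₀`, of the paths in the torus. -/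
def pathsLift : C(unitInterval × PathsFrom (torusProj y₀), Plane) :=
  isCoveringMap_torusProj.liftHomotopy (pathsEval y₀) (ContinuousMap.const _ y₀) fun γ => γ.2

theorem torusProj_pathsLift (s : unitInterval) (γ : PathsFrom (torusProj y₀)) :
    torusProj (pathsLift y₀ (s, γ)) = γ.1 s :=
  congrFun (isCoveringMap_torusProj.liftHomotopy_lifts (pathsEval y₀)
    (ContinuousMap.const _ y₀) fun γ => γ.2) (s, γ)

theorem pathsLift_zero (γ : PathsFrom (torusProj y₀)) : pathsLift y₀ (0, γ) = y₀ :=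
  isCoveringMap_torusProj.liftHomotopy_zero (pathsEval y₀) (ContinuousMap.const _ y₀)
    (fun γ => γ.2) γ

/-- The end point of the lift of a path. -/
def develop (γ : PathsFrom (torusProj y₀)) : Plane := pathsLift y₀ (1, γ)

/-- All paths are lifted at once, as one homotopy parametrized by `PathsFrom`; continuity in the
path is thus part of homotopy lifting. -/
theorem continuous_develop : Continuous (develop y₀) :=
  (pathsLift y₀).continuous.comp (by fun_prop)

theorem torusProj_develop (γ : PathsFrom (torusProj y₀)) :
    torusProj (develop y₀ γ) = γ.target := torusProj_pathsLift y₀ 1 γ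

/-- The lift of a path, as a path in the plane. -/
def developPath (γ : PathsFrom (torusProj y₀)) : Path y₀ (develop y₀ γ) where
  toFun s := pathsLift y₀ (s, γ)
  continuous_toFun := by fun_prop
  source' := pathsLift_zero y₀ γ
  target' := rfl

theorem loop_eq_latticeLoop (γ γ' : PathsFrom (torusProj y₀)) (h : γ'.target = γ.target)
    (n : ℤ × ℤ) (hn : develop y₀ γ = develop y₀ γ' + latticeVec n) :
    γ.loop γ' h = latticeLoop y₀ n := by
  refine fromPath_mk_eq_latticeLoop _ ((developPath y₀ γ).trans
    ((((developPath y₀ γ').translate (latticeVec n)).cast rfl hn).symm)) n rfl fun s => ?_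
  simp only [Path.trans_apply]
  split_ifs
  · exact torusProj_pathsLift y₀ _ γ
  · exact (torusProj_add_latticeVec _ _).trans (torusProj_pathsLift y₀ _ γ')

/-- The image in the torus of the segment from `y₀` to `x`. -/
def segmentPath (x : Plane) : PathsFrom (torusProj y₀) :=
  ⟨⟨fun s => torusProj (planeSegment y₀ x s),
    continuous_torusProj.comp (planeSegment y₀ x).continuous⟩,
    congrArg torusProj (planeSegment y₀ x).source⟩

theorem continuous_segmentPath : Continuous (segmentPath y₀) := by
  refine Continuous.subtype_mk (ContinuousMap.continuous_of_continuous_uncurry _ ?_) _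
  refine continuous_torusProj.comp ?_
  change Continuous fun u : Plane × unitInterval => y₀ + (u.2 : ℝ) • (u.1 - y₀)
  fun_prop

theorem target_segmentPath (x : Plane) : (segmentPath y₀ x).target = torusProj x :=
  congrArg torusProj (planeSegment y₀ x).target

theorem develop_segmentPath (x : Plane) : develop y₀ (segmentPath y₀ x) = x := by
  have : (fun s => pathsLift y₀ (s, segmentPath y₀ x)) = planeSegment y₀ x :=
    isCoveringMap_torusProj.eq_of_comp_eq (by fun_prop) (planeSegment y₀ x).continuous
      (funext fun s => torusProj_pathsLift y₀ s (segmentPath y₀ x)) 0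
      ((pathsLift_zero y₀ _).trans (planeSegment y₀ x).source.symm)
  exact (congrFun this 1).trans (planeSegment y₀ x).target

end Development

/-! ### Local constancy of the holonomy -/

section Holonomy

variable {G : Type*} [Group G] (ζ : Multiplicative (ℤ × ℤ) →* G)

/-- A homomorphism on the lattice, extended to the plane by rounding. -/
def roundHom (v : Plane) : G := ζ (Multiplicative.ofAdd (round v.1, round v.2))

theorem roundHom_add (v : Plane) (n : ℤ × ℤ) :
    roundHom ζ (v + latticeVec n) = roundHom ζ v * ζ (Multiplicative.ofAdd n) := by
  rw [roundHom, roundHom, ← map_mul, ← ofAdd_add]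
  simp only [latticeVec, Prod.fst_add, Prod.snd_add, round_add_intCast]
  rfl

theorem roundHom_latticeVec (n : ℤ × ℤ) :
    roundHom ζ (latticeVec n) = ζ (Multiplicative.ofAdd n) := by
  simp [roundHom, latticeVec]

/-- Rounding is locally constant near lattice points, though not everywhere. The continuity
arguments below evaluate `roundHom` at differences of two lifts of one point, which are lattice
points, so its jumps do no harm. -/
theorem roundHom_eventually_eq {v : Plane} (hv : torusProj v = 0) :
    ∀ᶠ w in 𝓝 v, roundHom ζ w = roundHom ζ v := by
  obtain ⟨m, n, rfl⟩ := torusProj_eq_zero_iff.1 hv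
  have key : ∀ (k : ℤ) (t : ℝ), dist t k < 1 / 2 → round t = k := by
    intro k t ht
    rw [Real.dist_eq, abs_lt] at ht
    rw [round_eq, Int.floor_eq_iff]
    constructor <;> linarith [ht.1, ht.2]
  filter_upwards [Metric.ball_mem_nhds _ (show (0 : ℝ) < 1 / 2 by norm_num)] with w hw
  rw [Metric.mem_ball, Prod.dist_eq, max_lt_iff] at hw
  simp only [roundHom, key m _ hw.1, key n _ hw.2, round_intCast]

end Holonomy

end

noncomputable section

open Topology

/-! ### Coordinates on the flat bundles over the torus -/

namespace FlatBundle

variable {y₀ : Plane} {G : Type*} [Group G] (η : FundamentalGroup Torus (torusProj y₀) →* G)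

/-- The holonomy of the flat bundle as a homomorphism on the lattice. -/
def holonomy : Multiplicative (ℤ × ℤ) →* G := η.comp (latticeHom y₀)

/-- The point of the bundle over `x` with coordinate `g` in the developed trivialization. -/
def ofCoord (x : Plane) (g : G) : FlatBundle η := Quot.mk _ (segmentPath y₀ x, g)

/-- The coordinate of a point of the bundle in the developed trivialization near `x`. -/
def coord (x : Plane) : FlatBundle η → G :=
  Quot.lift (fun u => roundHom (holonomy η) (develop y₀ u.1 - x) * u.2) (by
    rintro ⟨γ, g⟩ ⟨γ', g'⟩ ⟨h, hg⟩
    dsimp only at h hg ⊢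
    obtain ⟨n, hn⟩ := exists_latticeVec_of_torusProj_eq
      (x := develop y₀ γ) (y := develop y₀ γ')
      (by rw [torusProj_develop, torusProj_develop, h])
    rw [hg, loop_eq_latticeLoop y₀ γ γ' h n hn, hn, add_sub_right_comm, roundHom_add, mul_assoc]
    rfl)

theorem coord_mk (x : Plane) (γ : PathsFrom (torusProj y₀)) (g : G) :
    coord η x (Quot.mk _ (γ, g)) = roundHom (holonomy η) (develop y₀ γ - x) * g := rfl

theorem proj_ofCoord (x : Plane) (g : G) : proj η (ofCoord η x g) = torusProj x :=
  target_segmentPath y₀ x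

theorem coord_ofCoord (x : Plane) (g : G) : coord η x (ofCoord η x g) = g := by
  rw [ofCoord, coord_mk, develop_segmentPath, sub_self, ← latticeVec_zero, roundHom_latticeVec,
    ofAdd_zero, map_one, one_mul]

theorem ofCoord_coord {x : Plane} {e : FlatBundle η} (h : proj η e = torusProj x) :
    ofCoord η x (coord η x e) = e := by
  obtain ⟨⟨γ, g⟩, rfl⟩ := Quot.exists_rep e
  have h' : γ.target = torusProj x := h
  symm
  have ht : (segmentPath y₀ x).target = γ.target := (target_segmentPath y₀ x).trans h'.symm
  obtain ⟨n, hn⟩ := exists_latticeVec_of_torusProj_eq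
    (x := develop y₀ γ) (y := develop y₀ (segmentPath y₀ x))
    (by rw [torusProj_develop, torusProj_develop, ht])
  refine Quot.sound ⟨ht, ?_⟩
  change coord η x (Quot.mk _ (γ, g)) = η (γ.loop (segmentPath y₀ x) ht) * g
  rw [coord_mk, loop_eq_latticeLoop y₀ γ _ ht n hn, hn, develop_segmentPath, add_sub_cancel_left,
    roundHom_latticeVec]
  rfl

/-- Moving the reference point by `n` changes the displacement by -n, and commutativity of the
lattice brings the factor to the left. This is the sign that reappears in `latticeSpin`. -/
theorem coord_add_latticeVec (x : Plane) (n : ℤ × ℤ) (e : FlatBundle η) :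
    coord η (x + latticeVec n) e = holonomy η (Multiplicative.ofAdd (-n)) * coord η x e := by
  obtain ⟨⟨γ, g⟩, rfl⟩ := Quot.exists_rep e
  rw [coord_mk, coord_mk, ← sub_sub, sub_eq_add_neg _ (latticeVec n), ← latticeVec_neg,
    roundHom_add, ← mul_assoc]
  congr 1
  rw [roundHom, ← map_mul (holonomy η), ← map_mul (holonomy η), mul_comm]

theorem ofCoord_mul (x : Plane) (g h : G) :
    ofCoord η x (g * h) = MulOpposite.op h • ofCoord η x g := rfl

theorem coord_eq_mul {x y : Plane} (e : FlatBundle η) (h : torusProj y = torusProj x) :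
    coord η x e = roundHom (holonomy η) (y - x) * coord η y e := by
  obtain ⟨n, rfl⟩ := exists_latticeVec_of_torusProj_eq h
  rw [coord_add_latticeVec, add_sub_cancel_left, roundHom_latticeVec, ← mul_assoc, ← map_mul,
    ← ofAdd_add, add_neg_cancel, ofAdd_zero, map_one, one_mul]

section Topology

variable [TopologicalSpace G]

theorem continuous_ofCoord : Continuous fun u : Plane × G => ofCoord η u.1 u.2 :=
  continuous_quot_mk.comp
    (((continuous_segmentPath y₀).comp continuous_fst).prodMk continuous_snd)

theorem continuous_proj : Continuous (proj η) :=
  continuous_quot_lift _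
    (((continuous_eval_const (F := C(unitInterval, Torus)) 1).comp
      continuous_subtype_val).comp continuous_fst)

variable [ContinuousMul G]

/-- Continuity is tested before passing to the quotient. There the development minus the local
section is continuous with values in the lattice, so the holonomy factor is locally constant. -/
theorem continuousOn_coord_section {U : Set Torus} (hU : IsOpen U) {s : Torus → Plane}
    (hs : ContinuousOn s U) (hsU : ∀ x ∈ U, torusProj (s x) = x) :
    ContinuousOn (fun e => coord η (s (proj η e)) e) (proj η ⁻¹' U) := by
  have hq : IsQuotientMap (Quot.mk (flatBundleRel η)) := isQuotientMap_quot_mk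
  refine (hq.continuousOn_isOpen_iff (hU.preimage (continuous_proj η))).2 ?_
  have ht : Continuous fun u : PathsFrom (torusProj y₀) × G => u.1.target :=
    (continuous_proj η).comp continuous_quot_mk
  rintro ⟨γ, g⟩ hu
  apply ContinuousAt.continuousWithinAt
  have hu' : γ.target ∈ U := hu
  have hUn : ∀ᶠ u : PathsFrom (torusProj y₀) × G in 𝓝 (γ, g), u.1.target ∈ U :=
    ht.continuousAt.eventually (hU.mem_nhds hu')
  have hc : ContinuousAt (fun u : PathsFrom (torusProj y₀) × G =>
      develop y₀ u.1 - s u.1.target) (γ, g) := by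
    refine ((continuous_develop y₀).comp continuous_fst).continuousAt.sub ?_
    exact ContinuousAt.comp (f := fun u : PathsFrom (torusProj y₀) × G => u.1.target) (g := s)
      (hs.continuousAt (hU.mem_nhds hu')) ht.continuousAt
  have hz : torusProj (develop y₀ γ - s γ.target) = 0 := by
    rw [map_sub, torusProj_develop, hsU _ hu', sub_self]
  have := hc.eventually (roundHom_eventually_eq (holonomy η) hz)
  have hcont : ContinuousAt (fun u : PathsFrom (torusProj y₀) × G =>
      roundHom (holonomy η) (develop y₀ γ - s γ.target) * u.2) (γ, g) := by fun_prop
  refine hcont.congr ?_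
  filter_upwards [this] with u hu
  change _ = roundHom (holonomy η) (develop y₀ u.1 - s u.1.target) * u.2
  rw [hu]

theorem exists_local_section (x : Plane) : ∃ (U : Set Torus) (s : Torus → Plane), IsOpen U ∧
    torusProj x ∈ U ∧ ContinuousOn s U ∧ ∀ y ∈ U, torusProj (s y) = y := by
  obtain ⟨e, hx, he⟩ := isCoveringMap_torusProj.isLocalHomeomorph x
  have he' : ∀ z, torusProj z = e z := fun z => congrFun he z
  refine ⟨e.target, e.symm, e.open_target, ?_, e.continuousOn_symm, fun y hy => ?_⟩
  · rw [he']; exact e.map_source hx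
  · rw [he']; exact e.right_inv hy

/-- Near a given point, the coordinate along `x` is the coordinate along a local section times a
holonomy factor, which is locally constant on the set of compatible pairs. -/
theorem continuousOn_coord : ContinuousOn (fun u : Plane × FlatBundle η => coord η u.1 u.2)
    {u | torusProj u.1 = proj η u.2} := by
  rintro ⟨x, e⟩ (hu : torusProj x = proj η e)
  obtain ⟨U, s, hU, hxU, hs, hsU⟩ := exists_local_section x
  have heU : proj η e ∈ U := hu ▸ hxU
  have hp : ContinuousAt (fun u : Plane × FlatBundle η => proj η u.2) (x, e) :=
    ((continuous_proj η).comp continuous_snd).continuousAt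
  have hsp : ContinuousAt (fun u : Plane × FlatBundle η => s (proj η u.2) - u.1) (x, e) := by
    refine ContinuousAt.sub ?_ continuousAt_fst
    exact ContinuousAt.comp (f := fun u : Plane × FlatBundle η => proj η u.2) (g := s)
      (hs.continuousAt (hU.mem_nhds heU)) hp
  have hz : torusProj (s (proj η e) - x) = 0 := by rw [map_sub, hsU _ heU, hu, sub_self]
  have hev := hsp.eventually (roundHom_eventually_eq (holonomy η) hz)
  have h₁ : ContinuousAt (fun u : Plane × FlatBundle η => coord η (s (proj η u.2)) u.2) (x, e) :=
    ContinuousAt.comp (f := Prod.snd) (g := fun e => coord η (s (proj η e)) e)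
      ((continuousOn_coord_section η hU hs hsU).continuousAt
        ((hU.preimage (continuous_proj η)).mem_nhds heU)) continuousAt_snd
  have h₂ : ContinuousAt (fun u : Plane × FlatBundle η =>
      roundHom (holonomy η) (s (proj η e) - x) * coord η (s (proj η u.2)) u.2) (x, e) :=
    continuousAt_const.mul h₁
  refine h₂.continuousWithinAt.congr_of_eventuallyEq ?_
    (coord_eq_mul η e ((hsU _ heU).trans hu.symm))
  have hev' := (hev.and (hp.eventually (hU.mem_nhds heU)))
  filter_upwards [mem_nhdsWithin_of_mem_nhds hev', self_mem_nhdsWithin] with u hu₁ hu₂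
  rw [coord_eq_mul η u.2 ((hsU _ hu₁.2).trans (Eq.symm hu₂)), hu₁.1]

theorem continuous_coord_comp {A : Type*} [TopologicalSpace A] {x : A → Plane}
    {e : A → FlatBundle η} (hx : Continuous x) (he : Continuous e)
    (h : ∀ t, torusProj (x t) = proj η (e t)) : Continuous fun t => coord η (x t) (e t) := by
  refine continuousOn_univ.1 ?_
  have := (continuousOn_coord η).comp (hx.prodMk he).continuousOn (s := Set.univ) fun t _ => h t
  exact this

/-- A local section of the covering of the torus makes `ofCoord` and `coord` mutually inverse
charts, in which the action is right multiplication. -/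
theorem isPrincipalBundle : IsPrincipalBundle G (proj η) where
  continuous_proj := continuous_proj η
  continuous_smul := by
    refine ⟨continuous_iff_continuousAt.2 ?_⟩
    rintro ⟨h, e⟩
    obtain ⟨x, hx⟩ := torusProj_surjective (proj η e)
    obtain ⟨U, s, hU, hxU, hs, hsU⟩ := exists_local_section x
    rw [hx] at hxU
    have hUn := (hU.preimage (continuous_proj η)).mem_nhds hxU
    have h₁ : ContinuousAt (fun e => coord η (s (proj η e)) e) e :=
      (continuousOn_coord_section η hU hs hsU).continuousAt hUn
    have h₂ : ContinuousAt (fun e => s (proj η e)) e :=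
      ContinuousAt.comp (f := proj η) (g := s) (hs.continuousAt (hU.mem_nhds hxU))
        (continuous_proj η).continuousAt
    have h₃ : ContinuousAt (fun u : Gᵐᵒᵖ × FlatBundle η =>
        ofCoord η (s (proj η u.2)) (coord η (s (proj η u.2)) u.2 * u.1.unop)) (h, e) := by
      refine ContinuousAt.comp (f := fun u : Gᵐᵒᵖ × FlatBundle η =>
        (s (proj η u.2), coord η (s (proj η u.2)) u.2 * u.1.unop))
        (g := fun v : Plane × G => ofCoord η v.1 v.2) (continuous_ofCoord η).continuousAt ?_
      refine (ContinuousAt.comp (x := ((h, e) : Gᵐᵒᵖ × FlatBundle η)) (f := Prod.snd) h₂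
        continuousAt_snd).prodMk ?_
      exact (ContinuousAt.comp (x := ((h, e) : Gᵐᵒᵖ × FlatBundle η)) (f := Prod.snd) h₁
        continuousAt_snd).mul
        (MulOpposite.continuous_unop.comp continuous_fst).continuousAt
    refine h₃.congr ?_
    filter_upwards [continuousAt_snd.eventually hUn] with u hu
    rw [ofCoord_mul, ofCoord_coord η (hsU _ hu).symm, MulOpposite.op_unop]
  locally_trivial := by
    intro b
    obtain ⟨x, rfl⟩ := torusProj_surjective b
    obtain ⟨U, s, hU, hxU, hs, hsU⟩ := exists_local_section x
    refine ⟨U, hU, hxU, ?_⟩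
    let φ : (U × G) ≃ₜ (proj η ⁻¹' U) :=
      { toFun := fun u => ⟨ofCoord η (s u.1) u.2, by
          rw [Set.mem_preimage, proj_ofCoord, hsU _ u.1.2]; exact u.1.2⟩
        invFun := fun e => (⟨proj η e.1, e.2⟩, coord η (s (proj η e.1)) e.1)
        left_inv := fun u => by
          have h : proj η (ofCoord η (s u.1) u.2) = u.1 := by
            rw [proj_ofCoord, hsU _ u.1.2]
          refine Prod.ext (Subtype.ext h) ?_
          dsimp only
          rw [h, coord_ofCoord]
        right_inv := fun e => Subtype.ext (ofCoord_coord η (hsU _ e.2).symm)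
        continuous_toFun := by
          have h₁ : Continuous fun u : U × G => (s u.1, u.2) :=
            (hs.domRestrict.comp continuous_fst).prodMk continuous_snd
          exact ((continuous_ofCoord η).comp h₁).subtype_mk _
        continuous_invFun := by
          refine Continuous.prodMk ?_ ?_
          · exact ((continuous_proj η).comp continuous_subtype_val).subtype_mk _
          · exact (continuousOn_coord_section η hU hs hsU).domRestrict }
    refine ⟨φ, fun u g => ⟨?_, fun h => rfl⟩⟩
    change proj η (ofCoord η (s u) g) = u
    rw [proj_ofCoord, hsU _ u.2]

end Topology

end FlatBundle

end

noncomputable section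

open Topology

/-! ### Signs -/

/-- The sign `± 1` of an element of `ℤ/2`, as a unit quaternion. -/
def quatSign (a : ZMod 2) : UnitQuaternion := if a = 0 then 1 else -1

/-- The difference modulo 2 of two unit quaternions that are equal up to sign. -/
def signDiff (x y : UnitQuaternion) : ZMod 2 := open Classical in if x = y then 0 else 1

theorem UnitQuaternion.neg_one_ne_one : (-1 : UnitQuaternion) ≠ 1 := by
  intro h
  have h' : (-1 : ℝ) = 1 := congrArg (fun a : UnitQuaternion => (a : Quaternion ℝ).re) h
  norm_num at h'

theorem quatSign_zero : quatSign 0 = 1 := if_pos rfl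

theorem quatSign_one : quatSign 1 = -1 := if_neg one_ne_zero

theorem ZMod.two_eq_zero_or_one (a : ZMod 2) : a = 0 ∨ a = 1 := by
  fin_cases a
  · exact Or.inl rfl
  · exact Or.inr rfl

theorem quatSign_add (a b : ZMod 2) : quatSign (a + b) = quatSign a * quatSign b := by
  rcases ZMod.two_eq_zero_or_one a with rfl | rfl <;>
    rcases ZMod.two_eq_zero_or_one b with rfl | rfl
  · rw [add_zero, quatSign_zero, one_mul]
  · rw [zero_add, quatSign_zero, one_mul]
  · rw [add_zero, quatSign_zero, mul_one]
  · rw [CharTwo.add_self_eq_zero, quatSign_zero, quatSign_one, neg_mul_neg, one_mul]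

theorem quatSign_injective : Function.Injective quatSign := by
  intro a b h
  rcases ZMod.two_eq_zero_or_one a with rfl | rfl <;>
    rcases ZMod.two_eq_zero_or_one b with rfl | rfl
  · rfl
  · rw [quatSign_zero, quatSign_one] at h
    exact absurd h.symm UnitQuaternion.neg_one_ne_one
  · rw [quatSign_zero, quatSign_one] at h
    exact absurd h UnitQuaternion.neg_one_ne_one
  · rfl

theorem mul_quatSign (a : ZMod 2) (x : UnitQuaternion) : x * quatSign a = quatSign a * x := by
  rcases ZMod.two_eq_zero_or_one a with rfl | rfl
  · rw [quatSign_zero, mul_one, one_mul]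
  · rw [quatSign_one, neg_mul, mul_neg, mul_one, one_mul]

theorem quatSign_mul_eq_iff {a b : ZMod 2} {x : UnitQuaternion} :
    quatSign a * x = quatSign b * x ↔ a = b := by
  rw [mul_left_inj, quatSign_injective.eq_iff]

theorem spin_quatSign (a : ZMod 2) : spin (quatSign a) = 1 := by
  rw [spin_eq_one_iff, quatSign]
  split_ifs
  · exact Or.inl rfl
  · exact Or.inr rfl

theorem eq_signDiff_mul {x y : UnitQuaternion} (h : spin x = spin y) :
    x = quatSign (signDiff x y) * y := by
  rw [signDiff]
  split_ifs with hxy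
  · rw [quatSign_zero, one_mul, hxy]
  · rw [quatSign_one, neg_mul, one_mul]
    exact ((spin_eq_iff x y).1 h).resolve_left hxy

/-! ### The extension cocycle of a homomorphism to the rotation group -/

section ExtensionCocycle

/-- A unit quaternion above a given rotation. -/
def spinLift : SO3 → UnitQuaternion := Function.surjInv spin_surjective

theorem spin_spinLift (g : SO3) : spin (spinLift g) = g := Function.surjInv_eq spin_surjective g

variable (ζ : Multiplicative (ℤ × ℤ) →* SO3)

/-- The chosen lift to the unit quaternions of the value of `ζ` at `-n`. -/
def latticeSpin (n : ℤ × ℤ) : UnitQuaternion := spinLift (ζ (Multiplicative.ofAdd (-n)))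

theorem spin_latticeSpin (n : ℤ × ℤ) : spin (latticeSpin ζ n) = ζ (Multiplicative.ofAdd (-n)) :=
  spin_spinLift _

/-- The 2-cocycle of the lattice that obstructs lifting `ζ` to the unit quaternions. -/
def extCocycle (m n : ℤ × ℤ) : ZMod 2 :=
  signDiff (latticeSpin ζ m * latticeSpin ζ n) (latticeSpin ζ (m + n))

theorem latticeSpin_mul (m n : ℤ × ℤ) : latticeSpin ζ m * latticeSpin ζ n =
    quatSign (extCocycle ζ m n) * latticeSpin ζ (m + n) := by
  apply eq_signDiff_mul
  rw [map_mul, spin_latticeSpin, spin_latticeSpin, spin_latticeSpin, ← map_mul, ← ofAdd_add,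
    neg_add]

/-- Both bracketings of the product of three chosen lifts are a central sign times the chosen lift
for a + b + c; associativity equates the signs. -/
theorem extCocycle_add (a b c : ℤ × ℤ) :
    extCocycle ζ a b + extCocycle ζ (a + b) c = extCocycle ζ b c + extCocycle ζ a (b + c) := by
  apply quatSign_mul_eq_iff (x := latticeSpin ζ (a + b + c)).1
  have h := mul_assoc (latticeSpin ζ a) (latticeSpin ζ b) (latticeSpin ζ c)
  rw [latticeSpin_mul, latticeSpin_mul, mul_assoc, latticeSpin_mul, ← mul_assoc (latticeSpin ζ a),
    mul_quatSign, mul_assoc, latticeSpin_mul, ← mul_assoc, ← mul_assoc, ← quatSign_add,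
    ← quatSign_add, ← add_assoc a b c] at h
  exact h

end ExtensionCocycle

/-! ### Lattice displacements of singular edges of the torus -/

section Displacement

/-- A set-theoretic section of the universal covering of the torus. -/
def torusLift : Torus → Plane := Function.surjInv torusProj_surjective

theorem torusProj_torusLift (x : Torus) : torusProj (torusLift x) = x :=
  Function.surjInv_eq torusProj_surjective x

theorem exists_simplexLift {n : ℕ} (σ : C(Simp n, Torus)) : ∃ τ : C(Simp n, Plane),
    (∀ t, torusProj (τ t) = σ t) ∧ τ (stdSimplex.vertex 0) = torusLift (σ (stdSimplex.vertex 0)) :=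
  isCoveringMap_torusProj.exists_lift_simplex σ _ (torusProj_torusLift _)

/-- The lift of a singular simplex of the torus whose first vertex is the chosen one. -/
def simplexLift {n : ℕ} (σ : C(Simp n, Torus)) : C(Simp n, Plane) := (exists_simplexLift σ).choose

theorem torusProj_simplexLift {n : ℕ} (σ : C(Simp n, Torus)) (t : Simp n) :
    torusProj (simplexLift σ t) = σ t := (exists_simplexLift σ).choose_spec.1 t

theorem simplexLift_vertex {n : ℕ} (σ : C(Simp n, Torus)) :
    simplexLift σ (stdSimplex.vertex 0) = torusLift (σ (stdSimplex.vertex 0)) :=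
  (exists_simplexLift σ).choose_spec.2

theorem latticeVec_injective : Function.Injective latticeVec := by
  intro m n h
  simp only [latticeVec, Prod.mk.injEq, Int.cast_inj] at h
  exact Prod.ext h.1 h.2

theorem eq_simplexLift_add {n : ℕ} {σ : C(Simp n, Torus)} {L : C(Simp n, Plane)}
    (hL : ∀ t, torusProj (L t) = σ t) {a : ℤ × ℤ}
    (h0 : L (stdSimplex.vertex 0) = torusLift (σ (stdSimplex.vertex 0)) + latticeVec a)
    (t : Simp n) : L t = simplexLift σ t + latticeVec a := by
  have := isCoveringMap_torusProj.lift_simplex_unique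
    (τ := L) (τ' := ⟨fun t => simplexLift σ t + latticeVec a, by fun_prop⟩)
    (fun t => (hL t).trans
      ((torusProj_add_latticeVec _ a).trans (torusProj_simplexLift σ t)).symm) 0
    (h0.trans (congrArg (· + latticeVec a) (simplexLift_vertex σ).symm))
  exact DFunLike.congr_fun this t

theorem exists_displacement (κ : C(Simp 1, Torus)) : ∃ n, simplexLift κ (stdSimplex.vertex 1) =
    torusLift (κ (stdSimplex.vertex 1)) + latticeVec n :=
  exists_latticeVec_of_torusProj_eq (by rw [torusProj_simplexLift, torusProj_torusLift])

/-- The displacement, in the lattice, of a singular edge of the torus. -/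
def displacement (κ : C(Simp 1, Torus)) : ℤ × ℤ := (exists_displacement κ).choose

theorem simplexLift_vertex_one (κ : C(Simp 1, Torus)) : simplexLift κ (stdSimplex.vertex 1) =
    torusLift (κ (stdSimplex.vertex 1)) + latticeVec (displacement κ) :=
  (exists_displacement κ).choose_spec

/-- Any lift of the edge may be used, since two lifts differ by a constant lattice vector. -/
theorem displacement_eq {κ : C(Simp 1, Torus)} {L : C(Simp 1, Plane)}
    (hL : ∀ t, torusProj (L t) = κ t) {a b : ℤ × ℤ}
    (h0 : L (stdSimplex.vertex 0) = torusLift (κ (stdSimplex.vertex 0)) + latticeVec a)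
    (h1 : L (stdSimplex.vertex 1) = torusLift (κ (stdSimplex.vertex 1)) + latticeVec b) :
    displacement κ = b - a := by
  have h := eq_simplexLift_add hL h0 (stdSimplex.vertex 1)
  rw [h1, simplexLift_vertex_one, add_assoc, add_right_inj, ← latticeVec_add,
    latticeVec_injective.eq_iff] at h
  rw [h, add_sub_cancel_right]

/-- One lift of the whole simplex attaches a lattice vector to each vertex, and displacements of
edges are differences of these. Additivity along a triangle and the cocycle condition below are read
off from this. -/
theorem exists_vertex_displacement {n : ℕ} {σ : C(Simp n, Torus)} {L : C(Simp n, Plane)}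
    (hL : ∀ t, torusProj (L t) = σ t) : ∃ m : Fin (n + 1) → ℤ × ℤ,
      (∀ i, L (stdSimplex.vertex i) = torusLift (σ (stdSimplex.vertex i)) + latticeVec (m i)) ∧
      ∀ (κ : C(Simp 1, Simp n)) (i j : Fin (n + 1)),
        κ (stdSimplex.vertex 0) = stdSimplex.vertex i →
        κ (stdSimplex.vertex 1) = stdSimplex.vertex j → displacement (σ.comp κ) = m j - m i := by
  have h : ∀ i, ∃ m, L (stdSimplex.vertex i) =
      torusLift (σ (stdSimplex.vertex i)) + latticeVec m := fun i =>
    exists_latticeVec_of_torusProj_eq (by rw [hL, torusProj_torusLift])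
  choose m hm using h
  refine ⟨m, hm, fun κ i j hi hj => displacement_eq (L := L.comp κ) (fun t => hL _) ?_ ?_⟩
  · rw [ContinuousMap.comp_apply, ContinuousMap.comp_apply, hi, hm]
  · rw [ContinuousMap.comp_apply, ContinuousMap.comp_apply, hj, hm]

theorem displacement_face_one (σ : C(Simp 2, Torus)) : displacement (σ.comp (simpFace 1 1)) =
    displacement (σ.comp (simpFace 1 2)) + displacement (σ.comp (simpFace 1 0)) := by
  obtain ⟨m, -, hm⟩ := exists_vertex_displacement (torusProj_simplexLift σ)
  rw [hm (simpFace 1 1) 0 2 (simpFace_vertex 1 1 0) (simpFace_vertex 1 1 1),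
    hm (simpFace 1 2) 0 1 (simpFace_vertex 1 2 0) (simpFace_vertex 1 2 1),
    hm (simpFace 1 0) 1 2 (simpFace_vertex 1 0 0) (simpFace_vertex 1 0 1)]
  abel

variable (ζ : Multiplicative (ℤ × ℤ) →* SO3)

/-- The pull-back to the singular complex of the torus of the extension cocycle. -/
def torusExtCocycle : SingularCochain Torus (ZMod 2) 2 := fun σ =>
  extCocycle ζ (displacement (σ.comp (simpFace 1 2))) (displacement (σ.comp (simpFace 1 0)))

theorem torusExtCocycle_mem : torusExtCocycle ζ ∈ SingularTwoCocycle Torus (ZMod 2) := by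
  rw [AddMonoidHom.mem_ker]
  funext σ
  obtain ⟨m, -, hm⟩ := exists_vertex_displacement (torusProj_simplexLift σ)
  have key : ∀ (i : Fin 4) (j : Fin 3),
      displacement ((σ.comp (simpFace 2 i)).comp (simpFace 1 j)) =
        m (i.succAbove (j.succAbove 1)) - m (i.succAbove (j.succAbove 0)) := by
    intro i j
    rw [ContinuousMap.comp_assoc]
    apply hm <;> rw [ContinuousMap.comp_apply, simpFace_vertex, simpFace_vertex]
  rw [singularCoboundary_two_apply]
  simp only [torusExtCocycle, key, Pi.zero_apply]
  -- The cocycle condition on a 3-simplex is the group cocycle identity for the three consecutive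
  -- differences.
  have h := extCocycle_add ζ (m 1 - m 0) (m 2 - m 1) (m 3 - m 2)
  rw [show m 1 - m 0 + (m 2 - m 1) = m 2 - m 0 by abel,
    show m 2 - m 1 + (m 3 - m 2) = m 3 - m 1 by abel] at h
  change extCocycle ζ (m 2 - m 1) (m 3 - m 2) + extCocycle ζ (m 2 - m 0) (m 3 - m 2) +
    extCocycle ζ (m 1 - m 0) (m 3 - m 1) + extCocycle ζ (m 1 - m 0) (m 2 - m 1) = 0
  generalize extCocycle ζ (m 2 - m 1) (m 3 - m 2) = p at *
  generalize extCocycle ζ (m 2 - m 0) (m 3 - m 2) = q at *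
  generalize extCocycle ζ (m 1 - m 0) (m 3 - m 1) = r at *
  generalize extCocycle ζ (m 1 - m 0) (m 2 - m 1) = s at *
  grind

end Displacement

end

noncomputable section

open Topology

/-! ### Sections over the 1-skeleton and their obstruction cochains -/

theorem exists_edge_SO3 (g h : SO3) : ∃ c : C(Simp 1, SO3),
    c (stdSimplex.vertex 0) = g ∧ c (stdSimplex.vertex 1) = h := by
  have hpc : IsPathConnected (Metric.sphere (0 : Quaternion ℝ) 1) := by
    refine isPathConnected_sphere ?_ 0 zero_le_one
    rw [Quaternion.rank_eq_four]
    norm_num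
  have : PathConnectedSpace UnitQuaternion := isPathConnected_iff_pathConnectedSpace.1 hpc
  let γ := PathConnectedSpace.somePath (spinLift g) (spinLift h)
  refine ⟨⟨fun t => spin (γ (stdSimplexHomeomorphUnitInterval t)), ?_⟩, ?_, ?_⟩
  · exact continuous_spin.comp (γ.continuous.comp stdSimplexHomeomorphUnitInterval.continuous)
  · change spin (γ 0) = g
    rw [γ.source, spin_spinLift]
  · change spin (γ 1) = h
    rw [γ.target, spin_spinLift]

namespace FlatBundle

variable {y₀ : Plane} (η : FundamentalGroup Torus (torusProj y₀) →* SO3)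

theorem nonempty_oneSkeletonSection : Nonempty (OneSkeletonSection (proj η)) := by
  let vert : Torus → FlatBundle η := fun x => ofCoord η (torusLift x) 1
  have hvert : ∀ x, proj η (vert x) = x := fun x => by rw [proj_ofCoord, torusProj_torusLift]
  have hc : ∀ κ : C(Simp 1, Torus), ∃ c : C(Simp 1, SO3), ∀ i : Fin 2,
      c (stdSimplex.vertex i) = coord η (simplexLift κ (stdSimplex.vertex i))
        (vert (κ (stdSimplex.vertex i))) := fun κ => by
    obtain ⟨c, h₀, h₁⟩ := exists_edge_SO3
      (coord η (simplexLift κ (stdSimplex.vertex 0)) (vert (κ (stdSimplex.vertex 0))))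
      (coord η (simplexLift κ (stdSimplex.vertex 1)) (vert (κ (stdSimplex.vertex 1))))
    exact ⟨c, Fin.forall_fin_two.2 ⟨h₀, h₁⟩⟩
  choose c hc using hc
  exact ⟨{
    vertex := vert
    proj_vertex := hvert
    edge := fun κ => ⟨fun t => ofCoord η (simplexLift κ t) (c κ t),
      (continuous_ofCoord η).comp ((simplexLift κ).continuous.prodMk (c κ).continuous)⟩
    proj_edge := fun κ t => (proj_ofCoord η _ _).trans (torusProj_simplexLift κ t)
    edge_vertex := fun κ i => by
      change ofCoord η (simplexLift κ _) (c κ _) = _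
      rw [hc, ofCoord_coord]
      rw [hvert, torusProj_simplexLift] }⟩

/-- The coordinates, along a map to the plane, of a map to the bundle. -/
def coordMap {A : Type*} [TopologicalSpace A] (L : C(A, Plane)) (τ : C(A, FlatBundle η))
    (h : ∀ t, torusProj (L t) = proj η (τ t)) : C(A, SO3) :=
  ⟨fun t => coord η (L t) (τ t), continuous_coord_comp η L.continuous τ.continuous h⟩

variable {η} (s : OneSkeletonSection (proj η))

theorem exists_edgeSpin (κ : C(Simp 1, Torus)) : ∃ l : C(Simp 1, UnitQuaternion),
    (∀ t, spin (l t) = coord η (simplexLift κ t) (s.edge κ t)) ∧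
    l (stdSimplex.vertex 0) = spinLift (coord η (torusLift (κ (stdSimplex.vertex 0)))
      (s.vertex (κ (stdSimplex.vertex 0)))) := by
  refine isCoveringMap_spin.exists_lift_simplex (coordMap η (simplexLift κ) (s.edge κ) fun t => ?_)
    _ ?_
  · rw [torusProj_simplexLift, s.proj_edge]
  · rw [spin_spinLift, ← simplexLift_vertex, ← s.edge_vertex]
    rfl

/-- The lift to the unit quaternions of a section over a singular edge. -/
def edgeSpin (κ : C(Simp 1, Torus)) : C(Simp 1, UnitQuaternion) := (exists_edgeSpin s κ).choose

theorem spin_edgeSpin (κ : C(Simp 1, Torus)) (t : Simp 1) :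
    spin (edgeSpin s κ t) = coord η (simplexLift κ t) (s.edge κ t) :=
  (exists_edgeSpin s κ).choose_spec.1 t

/-- The lift to the unit quaternions of a section over a vertex. -/
def vertexSpin (x : Torus) : UnitQuaternion := spinLift (coord η (torusLift x) (s.vertex x))

theorem edgeSpin_zero (κ : C(Simp 1, Torus)) :
    edgeSpin s κ (stdSimplex.vertex 0) = vertexSpin s (κ (stdSimplex.vertex 0)) :=
  (exists_edgeSpin s κ).choose_spec.2

/-- The sign by which the lift of a section over an edge differs from the chosen lifts. -/
def edgeSign : SingularCochain Torus (ZMod 2) 1 := fun κ =>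
  signDiff (edgeSpin s κ (stdSimplex.vertex 1))
    (latticeSpin (holonomy η) (displacement κ) * vertexSpin s (κ (stdSimplex.vertex 1)))

theorem edgeSpin_one (κ : C(Simp 1, Torus)) : edgeSpin s κ (stdSimplex.vertex 1) =
    quatSign (edgeSign s κ) * (latticeSpin (holonomy η) (displacement κ) *
      vertexSpin s (κ (stdSimplex.vertex 1))) := by
  apply eq_signDiff_mul
  rw [spin_edgeSpin, simplexLift_vertex_one, coord_add_latticeVec, map_mul, spin_latticeSpin,
    vertexSpin, spin_spinLift, s.edge_vertex]

/-- Along the lift `L` of `σ`, the section over the boundary is a loop in SO(3). It extends over the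
triangle if and only if it lifts to a closed loop of quaternions: an extension can itself be lifted,
and conversely a closed quaternion triangle can be filled. The equation says that the lift along
faces 2 and 0 ends where the lift along face 1 does. -/
theorem exists_extension_iff (σ : C(Simp 2, Torus)) :
    (∃ τ : C(Simp 2, FlatBundle η), (∀ t, proj η (τ t) = σ t) ∧
      ∀ i : Fin 3, τ.comp (simpFace 1 i) = s.edge (σ.comp (simpFace 1 i))) ↔
    edgeSpin s (σ.comp (simpFace 1 1)) (stdSimplex.vertex 1) =
      quatSign (edgeSign s (σ.comp (simpFace 1 2))) *
        latticeSpin (holonomy η) (displacement (σ.comp (simpFace 1 2))) *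
        edgeSpin s (σ.comp (simpFace 1 0)) (stdSimplex.vertex 1) := by
  let L := simplexLift σ
  have hL : ∀ t, torusProj (L t) = σ t := torusProj_simplexLift σ
  have f20 : simpFace 1 2 (stdSimplex.vertex 0) = stdSimplex.vertex 0 := simpFace_vertex 1 2 0
  have f21 : simpFace 1 2 (stdSimplex.vertex 1) = stdSimplex.vertex 1 := simpFace_vertex 1 2 1
  have f10 : simpFace 1 1 (stdSimplex.vertex 0) = stdSimplex.vertex 0 := simpFace_vertex 1 1 0
  have f11 : simpFace 1 1 (stdSimplex.vertex 1) = stdSimplex.vertex 2 := simpFace_vertex 1 1 1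
  have f00 : simpFace 1 0 (stdSimplex.vertex 0) = stdSimplex.vertex 1 := simpFace_vertex 1 0 0
  have f01 : simpFace 1 0 (stdSimplex.vertex 1) = stdSimplex.vertex 2 := simpFace_vertex 1 0 1
  have hL2 : ∀ t, L (simpFace 1 2 t) = simplexLift (σ.comp (simpFace 1 2)) t := fun t => by
    have := eq_simplexLift_add (L := L.comp (simpFace 1 2)) (σ := σ.comp (simpFace 1 2)) (a := 0)
      (fun t => hL _) (by
        rw [ContinuousMap.comp_apply, ContinuousMap.comp_apply, f20, latticeVec_zero, add_zero]
        exact simplexLift_vertex σ) t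
    rwa [latticeVec_zero, add_zero] at this
  have hL1 : ∀ t, L (simpFace 1 1 t) = simplexLift (σ.comp (simpFace 1 1)) t := fun t => by
    have := eq_simplexLift_add (L := L.comp (simpFace 1 1)) (σ := σ.comp (simpFace 1 1)) (a := 0)
      (fun t => hL _) (by
        rw [ContinuousMap.comp_apply, ContinuousMap.comp_apply, f10, latticeVec_zero, add_zero]
        exact simplexLift_vertex σ) t
    rwa [latticeVec_zero, add_zero] at this
  have hL0 : ∀ t, L (simpFace 1 0 t) = simplexLift (σ.comp (simpFace 1 0)) t +
      latticeVec (displacement (σ.comp (simpFace 1 2))) := fun t =>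
    eq_simplexLift_add (L := L.comp (simpFace 1 0)) (σ := σ.comp (simpFace 1 0))
      (fun t => hL _) (by
        rw [ContinuousMap.comp_apply, ContinuousMap.comp_apply, f00, ← f21, hL2,
          simplexLift_vertex_one, ContinuousMap.comp_apply]) t
  -- Over face 0, `L` is the chosen lift translated by the displacement of face 2. The factor
  -- corrects the coordinates accordingly, and the sign makes the path start where the lift over
  -- face 2 ends.
  let μ : C(Simp 1, UnitQuaternion) := ⟨fun t =>
    quatSign (edgeSign s (σ.comp (simpFace 1 2))) *
        latticeSpin (holonomy η) (displacement (σ.comp (simpFace 1 2))) *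
        edgeSpin s (σ.comp (simpFace 1 0)) t, by fun_prop⟩
  have hμ : ∀ t, spin (μ t) = coord η (L (simpFace 1 0 t)) (s.edge (σ.comp (simpFace 1 0)) t) := by
    intro t
    change spin (_ * _ * _) = _
    rw [map_mul, map_mul, spin_quatSign, one_mul, spin_latticeSpin, spin_edgeSpin, hL0,
      coord_add_latticeVec]
  have hμ0 : edgeSpin s (σ.comp (simpFace 1 2)) (stdSimplex.vertex 1) =
      μ (stdSimplex.vertex 0) := by
    change _ = _ * _ * edgeSpin s (σ.comp (simpFace 1 0)) (stdSimplex.vertex 0)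
    rw [edgeSpin_one, edgeSpin_zero, mul_assoc, ContinuousMap.comp_apply, ContinuousMap.comp_apply,
      f21, f00]
  change _ ↔ _ = μ (stdSimplex.vertex 1)
  constructor
  · rintro ⟨τ, hτ, hτf⟩
    have hτf' : ∀ i t, τ (simpFace 1 i t) = s.edge (σ.comp (simpFace 1 i)) t := fun i t =>
      DFunLike.congr_fun (hτf i) t
    obtain ⟨F, hF, hF0⟩ := isCoveringMap_spin.exists_lift_simplex
      (coordMap η L τ fun t => by rw [hL, hτ])
      (edgeSpin s (σ.comp (simpFace 1 2)) (stdSimplex.vertex 0)) (by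
        rw [spin_edgeSpin, ← hL2, ← hτf', f20]
        rfl)
    have hF' : ∀ t, spin (F t) = coord η (L t) (τ t) := hF
    have h2 : F.comp (simpFace 1 2) = edgeSpin s (σ.comp (simpFace 1 2)) :=
      isCoveringMap_spin.lift_simplex_unique (fun t => by
        rw [ContinuousMap.comp_apply, hF', hL2, hτf', spin_edgeSpin]) 0
        (by rw [ContinuousMap.comp_apply, f20, hF0])
    have h1 : F.comp (simpFace 1 1) = edgeSpin s (σ.comp (simpFace 1 1)) :=
      isCoveringMap_spin.lift_simplex_unique (fun t => by
        rw [ContinuousMap.comp_apply, hF', hL1, hτf', spin_edgeSpin]) 0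
        (by rw [ContinuousMap.comp_apply, f10, hF0, edgeSpin_zero, edgeSpin_zero,
          ContinuousMap.comp_apply, ContinuousMap.comp_apply, f20, f10])
    have h0 : F.comp (simpFace 1 0) = μ :=
      isCoveringMap_spin.lift_simplex_unique (fun t => by
        rw [ContinuousMap.comp_apply, hF', hτf', hμ]) 0
        (by rw [← hμ0, ← h2, ContinuousMap.comp_apply, ContinuousMap.comp_apply, f00, f21])
    rw [← h1, ← h0, ContinuousMap.comp_apply, ContinuousMap.comp_apply, f11, f01]
  · intro h
    obtain ⟨F, hF⟩ := exists_simplex_unitQuaternion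
      ![μ, edgeSpin s (σ.comp (simpFace 1 1)), edgeSpin s (σ.comp (simpFace 1 2))]
      (by
        change edgeSpin s _ _ = edgeSpin s _ _
        rw [edgeSpin_zero, edgeSpin_zero, ContinuousMap.comp_apply, ContinuousMap.comp_apply,
          f20, f10])
      hμ0 h
    refine ⟨⟨fun t => ofCoord η (L t) (spin (F t)), (continuous_ofCoord η).comp
      (L.continuous.prodMk (continuous_spin.comp F.continuous))⟩, fun t => ?_, fun i => ?_⟩
    · exact (proj_ofCoord η _ _).trans (hL t)
    · ext1 t
      change ofCoord η (L (simpFace 1 i t)) (spin (F (simpFace 1 i t))) = _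
      have key : spin (F (simpFace 1 i t)) =
          coord η (L (simpFace 1 i t)) (s.edge (σ.comp (simpFace 1 i)) t) := by
        have hFi : F (simpFace 1 i t) = _ := DFunLike.congr_fun (hF i) t
        rw [hFi]
        fin_cases i
        · exact hμ t
        · exact (spin_edgeSpin s _ t).trans (by rw [← hL1]; rfl)
        · exact (spin_edgeSpin s _ t).trans (by rw [← hL2]; rfl)
      rw [key, ofCoord_coord]
      rw [s.proj_edge, hL]
      rfl

/-- Inserting `edgeSpin_one` in the closing condition leaves, on both sides, a sign times the same
quaternion. So an extension exists exactly when the three edge signs and the extension cocycle add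
up to 0, and in ℤ/2 this determines the obstruction. -/
theorem obstruction_eq : s.obstruction =
    singularCoboundary Torus (ZMod 2) 1 (edgeSign s) + torusExtCocycle (holonomy η) := by
  funext σ
  have key := exists_extension_iff s σ
  rw [edgeSpin_one, edgeSpin_one] at key
  rw [Pi.add_apply, singularCoboundary_one_apply]
  have hv : (σ.comp (simpFace 1 1)) (stdSimplex.vertex 1) =
      (σ.comp (simpFace 1 0)) (stdSimplex.vertex 1) :=
    congrArg σ ((simpFace_vertex 1 1 1).trans (simpFace_vertex 1 0 1).symm)
  rw [hv, mul_assoc (quatSign _) (latticeSpin _ _), ← mul_assoc (latticeSpin _ _) (quatSign _),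
    mul_quatSign, mul_assoc (quatSign _) (latticeSpin _ _),
    ← mul_assoc (latticeSpin _ _) (latticeSpin _ _), latticeSpin_mul, ← displacement_face_one,
    mul_assoc (quatSign _) (latticeSpin _ _), ← mul_assoc, ← mul_assoc, ← quatSign_add,
    ← mul_assoc, ← quatSign_add] at key
  rw [mul_assoc, quatSign_mul_eq_iff] at key
  change _ = _ + _ + _ + extCocycle _ _ _
  generalize edgeSign s (σ.comp (simpFace 1 0)) = a at *
  generalize edgeSign s (σ.comp (simpFace 1 1)) = b at *
  generalize edgeSign s (σ.comp (simpFace 1 2)) = c at *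
  generalize extCocycle (holonomy η) _ _ = d at *
  rw [OneSkeletonSection.obstruction]
  split_ifs with h
  · rw [key.1 h]
    grind
  · have h' := mt key.2 h
    revert h'
    clear key
    revert a b c d
    decide

end FlatBundle

end

noncomputable section

open Topology

/-! ### Cones over singular simplices of the plane -/

/-- The simplex as a quotient of the cylinder over its face: `(s, x) ↦ (s, (1 - s) x)`. -/
def simpJoin (n : ℕ) : C(unitInterval × Simp n, Simp (n + 1)) :=
  ⟨fun u => ⟨Fin.cons (u.1 : ℝ) fun k => (1 - (u.1 : ℝ)) * u.2 k, by
    constructor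
    · intro k
      refine Fin.cases u.1.2.1 (fun k => ?_) k
      exact mul_nonneg (sub_nonneg.2 u.1.2.2) (stdSimplex.zero_le u.2 k)
    · rw [Fin.sum_univ_succ]
      simp only [Fin.cons_zero, Fin.cons_succ]
      rw [← Finset.mul_sum, stdSimplex.sum_eq_one]
      ring⟩, by
    refine Continuous.subtype_mk (continuous_pi fun k => ?_) _
    refine Fin.cases ?_ (fun k => ?_) k
    · simp only [Fin.cons_zero]
      fun_prop
    · simp only [Fin.cons_succ]
      exact (continuous_const.sub (continuous_subtype_val.comp continuous_fst)).mul
        ((continuous_apply k).comp (continuous_subtype_val.comp continuous_snd))⟩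

theorem simpJoin_zero {n : ℕ} (u : unitInterval × Simp n) : simpJoin n u 0 = u.1 := rfl

theorem simpJoin_succ {n : ℕ} (u : unitInterval × Simp n) (k : Fin (n + 1)) :
    simpJoin n u k.succ = (1 - (u.1 : ℝ)) * u.2 k := rfl

theorem simpJoin_surjective (n : ℕ) : Function.Surjective (simpJoin n) := by
  intro t
  have hsum : t 0 + ∑ k : Fin (n + 1), t k.succ = 1 := by
    rw [← Fin.sum_univ_succ, stdSimplex.sum_eq_one]
  have ht0 : t 0 ≤ 1 := stdSimplex.le_one t 0
  by_cases h : t 0 = 1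
  · have hz : ∀ k : Fin (n + 1), t k.succ = 0 := by
      have : ∑ k : Fin (n + 1), t k.succ = 0 := by linarith
      intro k
      exact (Finset.sum_eq_zero_iff_of_nonneg fun k _ => stdSimplex.zero_le t k.succ).1 this k
        (Finset.mem_univ k)
    refine ⟨(1, stdSimplex.vertex 0), stdSimplex.ext (funext fun k => ?_)⟩
    refine Fin.cases ?_ (fun k => ?_) k
    · rw [simpJoin_zero, h]; rfl
    · rw [simpJoin_succ, hz]; simp
  · have hne : 1 - t 0 ≠ 0 := fun h' => h (by linarith)
    refine ⟨(⟨t 0, stdSimplex.zero_le t 0, ht0⟩, ⟨fun k => t k.succ / (1 - t 0),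
      fun k => div_nonneg (stdSimplex.zero_le t _) (by linarith), ?_⟩),
      stdSimplex.ext (funext fun k => ?_)⟩
    · rw [← Finset.sum_div, div_eq_one_iff_eq hne]
      linarith
    · refine Fin.cases ?_ (fun k => ?_) k
      · rw [simpJoin_zero]
      · rw [simpJoin_succ]
        exact mul_div_cancel₀ _ hne

theorem isQuotientMap_simpJoin (n : ℕ) : IsQuotientMap (simpJoin n) :=
  (simpJoin n).continuous.isClosedMap.isQuotientMap (simpJoin n).continuous (simpJoin_surjective n)

section Cone

variable {n : ℕ} (v : Plane)

/-- The cone with apex `v`, before passing to the quotient. -/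
def cylinderMap (σ : C(Simp n, Plane)) : C(unitInterval × Simp n, Plane) :=
  ⟨fun u => (u.1 : ℝ) • v + (1 - (u.1 : ℝ)) • σ u.2, by fun_prop⟩

theorem cylinderMap_factorsThrough (σ : C(Simp n, Plane)) :
    Function.FactorsThrough (cylinderMap v σ) (simpJoin n) := by
  rintro ⟨s, x⟩ ⟨s', x'⟩ h
  have h0 : s = s' := Subtype.ext (congrArg (fun t : Simp (n + 1) => t 0) h)
  subst h0
  -- At s = 1 the whole slice is collapsed to the apex, where the cone does not depend on `x`.
  by_cases hs : (1 - (s : ℝ)) = 0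
  · simp only [cylinderMap, ContinuousMap.coe_mk, hs, zero_smul]
  · have hx : x = x' := stdSimplex.ext (funext fun k =>
      mul_left_cancel₀ hs (congrArg (fun t : Simp (n + 1) => t k.succ) h))
    rw [hx]

/-- The cone with apex `v` over a singular simplex of the plane. -/
def coneMap (σ : C(Simp n, Plane)) : C(Simp (n + 1), Plane) :=
  (isQuotientMap_simpJoin n).lift (cylinderMap v σ) (cylinderMap_factorsThrough v σ)

theorem coneMap_simpJoin (σ : C(Simp n, Plane)) (u : unitInterval × Simp n) :
    coneMap v σ (simpJoin n u) = (u.1 : ℝ) • v + (1 - (u.1 : ℝ)) • σ u.2 :=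
  DFunLike.congr_fun ((isQuotientMap_simpJoin n).lift_comp (cylinderMap v σ)
    (cylinderMap_factorsThrough v σ)) u

theorem simpFace_zero_eq_simpJoin (x : Simp n) : simpFace n 0 x = simpJoin n (0, x) := by
  refine stdSimplex.ext (funext fun k => ?_)
  refine Fin.cases ?_ (fun k => ?_) k
  · rw [simpFace_self, simpJoin_zero]; rfl
  · rw [simpJoin_succ, ← Fin.zero_succAbove, simpFace_succAbove]
    simp

theorem simpFace_succ_simpJoin (i : Fin (n + 2)) (s : unitInterval) (y : Simp n) :
    simpFace (n + 1) i.succ (simpJoin n (s, y)) = simpJoin (n + 1) (s, simpFace n i y) := by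
  refine stdSimplex.ext (funext fun k => ?_)
  by_cases hk : k = i.succ
  · rw [hk, simpFace_self, simpJoin_succ, simpFace_self, mul_zero]
  · obtain ⟨l, rfl⟩ := Fin.exists_succAbove_eq hk
    rw [simpFace_succAbove]
    refine Fin.cases ?_ (fun l => ?_) l
    · rw [simpJoin_zero, Fin.succ_succAbove_zero, simpJoin_zero]
    · rw [simpJoin_succ, Fin.succ_succAbove_succ, simpJoin_succ, simpFace_succAbove]

theorem coneMap_face_zero (σ : C(Simp n, Plane)) : (coneMap v σ).comp (simpFace n 0) = σ := by
  ext1 x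
  rw [ContinuousMap.comp_apply, simpFace_zero_eq_simpJoin, coneMap_simpJoin]
  simp

theorem coneMap_face_succ (σ : C(Simp (n + 1), Plane)) (i : Fin (n + 2)) :
    (coneMap v σ).comp (simpFace (n + 1) i.succ) = coneMap v (σ.comp (simpFace n i)) := by
  ext1 x
  obtain ⟨⟨s, y⟩, rfl⟩ := simpJoin_surjective n x
  rw [ContinuousMap.comp_apply, simpFace_succ_simpJoin, coneMap_simpJoin, coneMap_simpJoin]
  rfl

end Cone

/-- The faces of the cone over `σ` are `σ` and the cones over the faces of `σ`, so the cocycle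
condition on the cone exhibits the primitive. -/
theorem exists_primitive_two {F : SingularCochain Plane (ZMod 2) 2}
    (hF : singularCoboundary Plane (ZMod 2) 2 F = 0) :
    ∃ h, singularCoboundary Plane (ZMod 2) 1 h = F := by
  refine ⟨fun c => F (coneMap 0 c), funext fun σ => ?_⟩
  have := congrFun hF (coneMap 0 σ)
  rw [singularCoboundary_two_apply, coneMap_face_zero] at this
  rw [singularCoboundary_one_apply, ← coneMap_face_succ, ← coneMap_face_succ, ← coneMap_face_succ]
  simp only [Fin.succ_zero_eq_one, Fin.succ_one_eq_two, Fin.reduceSucc, Pi.zero_apply] at this ⊢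
  grind

theorem comp_simpFace_zero {X : Type*} [TopologicalSpace X] (c : C(Simp 1, X)) (i : Fin 2) :
    c.comp (simpFace 0 i) = ContinuousMap.const _ (c (stdSimplex.vertex (i.succAbove 0))) := by
  ext1 t
  have ht : t = stdSimplex.vertex 0 := by
    refine stdSimplex.ext (funext fun k => ?_)
    have := stdSimplex.sum_eq_one t
    rw [Fin.sum_univ_one] at this
    rw [Fin.fin_one_eq_zero k, this]
    simp
  rw [ContinuousMap.comp_apply, ht, simpFace_vertex]
  rfl

/-- The potential `k` at a point is the value of `l` on the segment from the origin; the cone over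
`c` has `c` and two such segments as its faces. -/
theorem exists_primitive_one {l : SingularCochain Plane (ZMod 2) 1}
    (hl : singularCoboundary Plane (ZMod 2) 1 l = 0) :
    ∃ k : Plane → ZMod 2, ∀ c, l c = k (c (stdSimplex.vertex 1)) + k (c (stdSimplex.vertex 0)) := by
  refine ⟨fun x => l (coneMap 0 (ContinuousMap.const (Simp 0) x)), fun c => ?_⟩
  have := congrFun hl (coneMap 0 c)
  have h₁ := coneMap_face_succ 0 c 0
  have h₂ := coneMap_face_succ 0 c 1
  rw [comp_simpFace_zero] at h₁ h₂
  rw [singularCoboundary_one_apply, coneMap_face_zero] at this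
  simp only [Fin.succ_zero_eq_one, Fin.succ_one_eq_two, Pi.zero_apply] at h₁ h₂ this
  rw [h₁, h₂] at this
  change l c + l (coneMap 0 (ContinuousMap.const (Simp 0) (c (stdSimplex.vertex 1)))) +
    l (coneMap 0 (ContinuousMap.const (Simp 0) (c (stdSimplex.vertex 0)))) = 0 at this
  grind

/-! ### Affine simplices and translations -/

/-- The affine simplex with given vertices. -/
def affineSimplex {n : ℕ} (v : Fin (n + 1) → Plane) : C(Simp n, Plane) :=
  ⟨fun t => ∑ i, t i • v i, continuous_finsetSum _ fun i _ =>
    ((continuous_apply i).comp continuous_subtype_val).smul continuous_const⟩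

theorem affineSimplex_vertex {n : ℕ} (v : Fin (n + 1) → Plane) (i : Fin (n + 1)) :
    affineSimplex v (stdSimplex.vertex i) = v i := by
  simp [affineSimplex, Pi.single_apply]

theorem affineSimplex_face {n : ℕ} (v : Fin (n + 2) → Plane) (i : Fin (n + 2)) :
    (affineSimplex v).comp (simpFace n i) = affineSimplex (v ∘ i.succAbove) := by
  ext1 t
  change ∑ j, (simpFace n i t) j • v j = ∑ j, t j • v (i.succAbove j)
  rw [Fin.sum_univ_succAbove _ i, simpFace_self, zero_smul, zero_add]
  simp only [simpFace_succAbove]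

/-- The translate of a singular simplex of the plane. -/
def translateSimplex {n : ℕ} (v : Plane) (σ : C(Simp n, Plane)) : C(Simp n, Plane) :=
  ⟨fun t => σ t + v, by fun_prop⟩

theorem translateSimplex_affineSimplex {n : ℕ} (w : Plane) (v : Fin (n + 1) → Plane) :
    translateSimplex w (affineSimplex v) = affineSimplex fun i => v i + w := by
  ext1 t
  change ∑ i, t i • v i + w = ∑ i, t i • (v i + w)
  simp only [smul_add, Finset.sum_add_distrib, ← Finset.sum_smul, stdSimplex.sum_eq_one, one_smul]

theorem translateSimplex_add {n : ℕ} (v w : Plane) (σ : C(Simp n, Plane)) :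
    translateSimplex v (translateSimplex w σ) = translateSimplex (w + v) σ := by
  ext1 t
  exact add_assoc _ _ _

theorem translateSimplex_zero {n : ℕ} (σ : C(Simp n, Plane)) : translateSimplex 0 σ = σ := by
  ext1 t
  exact add_zero _

/-- The covering map of the torus as a continuous map. -/
def torusCovering : C(Plane, Torus) := ⟨torusProj, continuous_torusProj⟩

theorem torusCovering_comp_translateSimplex {n : ℕ} (m : ℤ × ℤ) (σ : C(Simp n, Plane)) :
    torusCovering.comp (translateSimplex (latticeVec m) σ) = torusCovering.comp σ := by
  ext1 t
  exact torusProj_add_latticeVec _ _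

/-! ### Functions with prescribed increments along the lattice -/

/-- The shear `(x, t) ↦ (x + e, t + k x)`. -/
def shearPerm (e : Plane) (k : Plane → ZMod 2) : Equiv.Perm (Plane × ZMod 2) where
  toFun u := (u.1 + e, u.2 + k u.1)
  invFun u := (u.1 - e, u.2 - k (u.1 - e))
  left_inv u := by simp
  right_inv u := by simp

theorem shearPerm_zpow_fst (e : Plane) (k : Plane → ZMod 2) (m : ℤ) (u : Plane × ZMod 2) :
    ((shearPerm e k ^ m) u).1 = u.1 + m • e := by
  induction m with
  | zero => simp
  | succ n ih =>
    rw [add_comm (n : ℤ) 1, zpow_one_add, Equiv.Perm.mul_apply]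
    change ((shearPerm e k ^ (n : ℤ)) u).1 + e = _
    rw [ih, add_smul, one_smul, add_assoc, add_comm e]
  | pred n ih =>
    rw [sub_eq_add_neg, add_comm (-(n : ℤ)), zpow_add, zpow_neg_one, Equiv.Perm.mul_apply]
    change ((shearPerm e k ^ (-(n : ℤ))) u).1 - e = _
    rw [ih, add_smul, neg_one_smul, add_sub_assoc, sub_eq_add_neg, add_comm (-e)]

/-- The prescribed increments define two shears of Plane × ℤ/2 over the unit translations, and `h`
says that they commute. They generate an action of ℤ², and an invariant graph over the plane is the
required function. -/
theorem exists_of_increments (k₁ k₂ : Plane → ZMod 2)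
    (h : ∀ x, k₁ (x + (0, 1)) + k₂ x = k₂ (x + (1, 0)) + k₁ x) :
    ∃ K : Plane → ZMod 2, (∀ x, K (x + (1, 0)) = K x + k₁ x) ∧
      ∀ x, K (x + (0, 1)) = K x + k₂ x := by
  let A := shearPerm (1, 0) k₁
  let B := shearPerm (0, 1) k₂
  have hAB : Commute A B := by
    refine Equiv.ext fun u => Prod.ext ?_ ?_
    · change u.1 + (0, 1) + (1, 0) = u.1 + (1, 0) + (0, 1)
      exact add_right_comm _ _ _
    · change u.2 + k₂ u.1 + k₁ (u.1 + (0, 1)) = u.2 + k₁ u.1 + k₂ (u.1 + (1, 0))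
      rw [add_assoc, add_assoc, add_comm (k₂ _), h, add_comm (k₂ _)]
  -- The graph is the orbit of the zero function on the half-open unit square: the integer parts of
  -- `x` say which shears to apply.
  let z : Plane → Plane × ZMod 2 := fun x =>
    (A ^ ⌊x.1⌋ * B ^ ⌊x.2⌋) ((Int.fract x.1, Int.fract x.2), 0)
  have hz : ∀ x, (z x).1 = x := fun x => by
    simp only [z, A, B, Equiv.Perm.mul_apply, shearPerm_zpow_fst]
    refine Prod.ext ?_ ?_ <;> simp
  have hz₁ : ∀ x, z (x + (1, 0)) = A (z x) := fun x => by
    simp only [z, Prod.fst_add, Prod.snd_add, add_zero, Int.floor_add_one, Int.fract_add_one,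
      ← Equiv.Perm.mul_apply]
    rw [add_comm, zpow_add, zpow_one, mul_assoc]
  have hz₂ : ∀ x, z (x + (0, 1)) = B (z x) := fun x => by
    simp only [z, Prod.fst_add, Prod.snd_add, add_zero, Int.floor_add_one, Int.fract_add_one,
      ← Equiv.Perm.mul_apply]
    rw [add_comm, zpow_add, zpow_one, ← mul_assoc, ← mul_assoc, (hAB.zpow_left _).eq]
  refine ⟨fun x => (z x).2, fun x => ?_, fun x => ?_⟩
  · dsimp only
    rw [hz₁]
    exact congrArg (fun y => (z x).2 + k₁ y) (hz x)
  · dsimp only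
    rw [hz₂]
    exact congrArg (fun y => (z x).2 + k₂ y) (hz x)

end

noncomputable section

open Topology

/-! ### The second cohomology of the torus -/

/-- The image in the torus of the lower half of the unit square. -/
def lowerTriangle : C(Simp 2, Torus) := torusCovering.comp (affineSimplex ![0, (1, 0), (1, 1)])

/-- The image in the torus of the upper half of the unit square. -/
def upperTriangle : C(Simp 2, Torus) := torusCovering.comp (affineSimplex ![0, (0, 1), (1, 1)])

/-- The image in the torus of the straight edge between two points of the plane. -/
def straightEdge (x y : Plane) : C(Simp 1, Torus) := torusCovering.comp (affineSimplex ![x, y])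

theorem affineTriangle_face (x y z : Plane) :
    (affineSimplex ![x, y, z]).comp (simpFace 1 0) = affineSimplex ![y, z] ∧
    (affineSimplex ![x, y, z]).comp (simpFace 1 1) = affineSimplex ![x, z] ∧
    (affineSimplex ![x, y, z]).comp (simpFace 1 2) = affineSimplex ![x, y] := by
  refine ⟨?_, ?_, ?_⟩ <;>
  · rw [affineSimplex_face]
    exact congrArg affineSimplex (funext fun i => by fin_cases i <;> rfl)

theorem translateSimplex_edge (w x y : Plane) :
    translateSimplex w (affineSimplex ![x, y]) = affineSimplex ![x + w, y + w] := by
  rw [translateSimplex_affineSimplex]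
  congr 1
  funext i
  fin_cases i <;> rfl

theorem straightEdge_add_latticeVec (x y : Plane) (n : ℤ × ℤ) :
    straightEdge (x + latticeVec n) (y + latticeVec n) = straightEdge x y := by
  rw [straightEdge, ← translateSimplex_edge, torusCovering_comp_translateSimplex, straightEdge]

theorem latticeVec_one_zero : latticeVec (1, 0) = (1, 0) := by simp [latticeVec]

theorem latticeVec_zero_one : latticeVec (0, 1) = (0, 1) := by simp [latticeVec]

/-- Evaluation of a cochain on the fundamental cycle of the torus. -/
def evalFundamental : SingularCochain Torus (ZMod 2) 2 →+ ZMod 2 where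
  toFun f := f lowerTriangle + f upperTriangle
  map_zero' := by simp
  map_add' f g := add_add_add_comm _ _ _ _

theorem lowerTriangle_face : lowerTriangle.comp (simpFace 1 0) = straightEdge 0 (0, 1) ∧
    lowerTriangle.comp (simpFace 1 1) = straightEdge 0 (1, 1) ∧
    lowerTriangle.comp (simpFace 1 2) = straightEdge 0 (1, 0) := by
  obtain ⟨h₀, h₁, h₂⟩ := affineTriangle_face 0 (1, 0) (1, 1)
  simp only [lowerTriangle, ContinuousMap.comp_assoc, h₀, h₁, h₂]
  refine ⟨?_, rfl, rfl⟩
  rw [← straightEdge_add_latticeVec 0 (0, 1) (1, 0), latticeVec_one_zero]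
  simp [straightEdge]

theorem upperTriangle_face : upperTriangle.comp (simpFace 1 0) = straightEdge 0 (1, 0) ∧
    upperTriangle.comp (simpFace 1 1) = straightEdge 0 (1, 1) ∧
    upperTriangle.comp (simpFace 1 2) = straightEdge 0 (0, 1) := by
  obtain ⟨h₀, h₁, h₂⟩ := affineTriangle_face 0 (0, 1) (1, 1)
  simp only [upperTriangle, ContinuousMap.comp_assoc, h₀, h₁, h₂]
  refine ⟨?_, rfl, rfl⟩
  rw [← straightEdge_add_latticeVec 0 (1, 0) (0, 1), latticeVec_zero_one]
  simp [straightEdge]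

/-- The two triangles have the same three edges in the torus, so everything cancels modulo 2. -/
theorem evalFundamental_coboundary (g : SingularCochain Torus (ZMod 2) 1) :
    evalFundamental (singularCoboundary Torus (ZMod 2) 1 g) = 0 := by
  obtain ⟨h₀, h₁, h₂⟩ := lowerTriangle_face
  obtain ⟨k₀, k₁, k₂⟩ := upperTriangle_face
  change singularCoboundary Torus (ZMod 2) 1 g _ + singularCoboundary Torus (ZMod 2) 1 g _ = 0
  rw [singularCoboundary_one_apply, singularCoboundary_one_apply, h₀, h₁, h₂, k₀, k₁, k₂]
  grind

/-- A cochain on the plane that is invariant under the lattice descends to the torus. -/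
theorem exists_descent {h : SingularCochain Plane (ZMod 2) 1}
    {f : SingularCochain Torus (ZMod 2) 2}
    (hinv : ∀ n c, h (translateSimplex (latticeVec n) c) = h c)
    (hf : ∀ σ, singularCoboundary Plane (ZMod 2) 1 h σ = f (torusCovering.comp σ)) :
    ∃ g, singularCoboundary Torus (ZMod 2) 1 g = f := by
  refine ⟨fun κ => h (simplexLift κ), funext fun σ => ?_⟩
  have hlift : torusCovering.comp (simplexLift σ) = σ :=
    ContinuousMap.ext (torusProj_simplexLift σ)
  -- The chosen lift of a face and the face of the chosen lift differ by a lattice translation,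
  -- under which `h` is invariant.
  have key : ∀ i, h (simplexLift (σ.comp (simpFace 1 i))) =
      h ((simplexLift σ).comp (simpFace 1 i)) := by
    intro i
    have hp : ∀ t, torusProj (((simplexLift σ).comp (simpFace 1 i)) t) =
        (σ.comp (simpFace 1 i)) t := fun t => torusProj_simplexLift σ _
    obtain ⟨a, ha⟩ := exists_latticeVec_of_torusProj_eq
      (x := ((simplexLift σ).comp (simpFace 1 i)) (stdSimplex.vertex 0))
      (y := torusLift ((σ.comp (simpFace 1 i)) (stdSimplex.vertex 0)))
      (by rw [hp, torusProj_torusLift])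
    rw [← hinv a]
    congr 1
    ext1 t
    exact (eq_simplexLift_add hp ha t).symm
  rw [singularCoboundary_one_apply, key, key, key, ← singularCoboundary_one_apply, hf, hlift]

/-- On the plane the pulled-back cocycle has a primitive `h`, in general not invariant under the
lattice. Its defects under the two unit translations are coboundaries of functions `k₁`, `k₂`. A
correction of `h` by a coboundary of `K` removes both defects if these functions are compatible, and
the obstruction to compatibility is the value on the fundamental cycle. -/
theorem exists_primitive_of_evalFundamental {f : SingularCochain Torus (ZMod 2) 2}
    (hf : singularCoboundary Torus (ZMod 2) 2 f = 0) (h0 : evalFundamental f = 0) :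
    ∃ g, singularCoboundary Torus (ZMod 2) 1 g = f := by
  let F : SingularCochain Plane (ZMod 2) 2 := fun σ => f (torusCovering.comp σ)
  have hF : singularCoboundary Plane (ZMod 2) 2 F = 0 := by
    funext σ
    have := congrFun hf (torusCovering.comp σ)
    rw [singularCoboundary_two_apply] at this ⊢
    exact this
  obtain ⟨h, hh⟩ := exists_primitive_two hF
  have hh' : ∀ σ, h (σ.comp (simpFace 1 0)) + h (σ.comp (simpFace 1 1)) +
      h (σ.comp (simpFace 1 2)) = F σ := fun σ => by
    rw [← hh, singularCoboundary_one_apply]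
  -- `F` is invariant under the lattice, so the defect of `h` under a translation is a 1-cocycle on
  -- the plane.
  have hk : ∀ n : ℤ × ℤ, ∃ k : Plane → ZMod 2, ∀ c : C(Simp 1, Plane),
      h (translateSimplex (latticeVec n) c) + h c =
        k (c (stdSimplex.vertex 1)) + k (c (stdSimplex.vertex 0)) := by
    intro n
    refine exists_primitive_one (l := fun c => h (translateSimplex (latticeVec n) c) + h c) ?_
    funext σ
    rw [singularCoboundary_one_apply]
    have h₁ := hh' (translateSimplex (latticeVec n) σ)
    have h₂ : F (translateSimplex (latticeVec n) σ) = F σ := by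
      simp only [F, torusCovering_comp_translateSimplex]
    rw [h₂, ← hh' σ] at h₁
    change h (translateSimplex (latticeVec n) (σ.comp (simpFace 1 0))) +
      h (translateSimplex (latticeVec n) (σ.comp (simpFace 1 1))) +
      h (translateSimplex (latticeVec n) (σ.comp (simpFace 1 2))) = _ at h₁
    rw [Pi.zero_apply]
    grind
  obtain ⟨k₁, hk₁⟩ := hk (1, 0)
  obtain ⟨k₂, hk₂⟩ := hk (0, 1)
  rw [latticeVec_one_zero] at hk₁
  rw [latticeVec_zero_one] at hk₂
  have hedge : ∀ x y : Plane, (affineSimplex ![x, y]) (stdSimplex.vertex 0) = x ∧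
      (affineSimplex ![x, y]) (stdSimplex.vertex 1) = y := fun x y =>
    ⟨affineSimplex_vertex _ _, affineSimplex_vertex _ _⟩
  have hk₁' : ∀ x y : Plane, h (affineSimplex ![x + (1, 0), y + (1, 0)]) +
      h (affineSimplex ![x, y]) = k₁ y + k₁ x := fun x y => by
    rw [← translateSimplex_edge, hk₁, (hedge x y).1, (hedge x y).2]
  have hk₂' : ∀ x y : Plane, h (affineSimplex ![x + (0, 1), y + (0, 1)]) +
      h (affineSimplex ![x, y]) = k₂ y + k₂ x := fun x y => by
    rw [← translateSimplex_edge, hk₂, (hedge x y).1, (hedge x y).2]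
  have hcomp : ∀ x, k₁ (x + (0, 1)) + k₂ x = k₂ (x + (1, 0)) + k₁ x := by
    -- At the origin the defects add up to `h` on the boundary of the unit square. The diagonal
    -- cancels, so this is the sum of `F` over the two triangles.
    have hsum : k₁ (0, 1) + k₁ 0 + (k₂ (1, 0) + k₂ 0) = 0 := by
      rw [← hk₁', ← hk₂']
      have h₁ := hh' (affineSimplex ![0, (1, 0), (1, 1)])
      have h₂ := hh' (affineSimplex ![0, (0, 1), (1, 1)])
      obtain ⟨a₀, a₁, a₂⟩ := affineTriangle_face 0 (1, 0) (1, 1)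
      obtain ⟨b₀, b₁, b₂⟩ := affineTriangle_face 0 (0, 1) (1, 1)
      rw [a₀, a₁, a₂] at h₁
      rw [b₀, b₁, b₂] at h₂
      have h₃ : F (affineSimplex ![0, (1, 0), (1, 1)]) + F (affineSimplex ![0, (0, 1), (1, 1)]) =
        0 := h0
      rw [← h₁, ← h₂] at h₃
      simp only [zero_add, Prod.mk_add_mk, add_zero]
      grind
    intro x
    -- In the sum of the four relations each translate of the segment from 0 to `x` occurs twice;
    -- hence compatibility at 0 gives compatibility at `x`.
    have e₁ := hk₁' (0 + (0, 1)) (x + (0, 1))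
    have e₂ := hk₂' 0 x
    have e₃ := hk₂' (0 + (1, 0)) (x + (1, 0))
    have e₄ := hk₁' 0 x
    rw [add_right_comm 0, add_right_comm x] at e₁
    rw [zero_add] at e₁ e₂ e₃ e₄
    rw [zero_add] at e₁
    grind
  obtain ⟨K, hK₁, hK₂⟩ := exists_of_increments k₁ k₂ hcomp
  let h' : SingularCochain Plane (ZMod 2) 1 := fun c =>
    h c + (K (c (stdSimplex.vertex 1)) + K (c (stdSimplex.vertex 0)))
  -- The translations that preserve `h'` form a group, so the two generators of the lattice suffice.
  let S : AddSubgroup Plane :=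
    { carrier := {v | ∀ c, h' (translateSimplex v c) = h' c}
      zero_mem' := fun c => by rw [translateSimplex_zero]
      add_mem' := fun {v w} hv hw c => by rw [← translateSimplex_add, hw, hv]
      neg_mem' := fun {v} hv c => by
        rw [← hv (translateSimplex (-v) c), translateSimplex_add, neg_add_cancel,
          translateSimplex_zero] }
  have hS₁ : ((1, 0) : Plane) ∈ S := fun c => by
    change h _ + (K (c _ + (1, 0)) + K (c _ + (1, 0))) = h c + _
    rw [hK₁, hK₁]
    have := hk₁ c
    grind
  have hS₂ : ((0, 1) : Plane) ∈ S := fun c => by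
    change h _ + (K (c _ + (0, 1)) + K (c _ + (0, 1))) = h c + _
    rw [hK₂, hK₂]
    have := hk₂ c
    grind
  have hS : ∀ n, latticeVec n ∈ S := fun n => by
    have : latticeVec n = n.1 • ((1, 0) : Plane) + n.2 • ((0, 1) : Plane) := by
      simp [latticeVec]
    rw [this]
    exact S.add_mem (S.zsmul_mem hS₁ _) (S.zsmul_mem hS₂ _)
  refine exists_descent (h := h') (fun n c => hS n c) fun σ => ?_
  rw [singularCoboundary_one_apply]
  change _ = F σ
  rw [← hh' σ]
  have v₂ : simpFace 1 0 (stdSimplex.vertex 1) = simpFace 1 1 (stdSimplex.vertex 1) :=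
    (simpFace_vertex 1 0 1).trans (simpFace_vertex 1 1 1).symm
  have v₁ : simpFace 1 0 (stdSimplex.vertex 0) = simpFace 1 2 (stdSimplex.vertex 1) :=
    (simpFace_vertex 1 0 0).trans (simpFace_vertex 1 2 1).symm
  have v₀ : simpFace 1 1 (stdSimplex.vertex 0) = simpFace 1 2 (stdSimplex.vertex 0) :=
    (simpFace_vertex 1 1 0).trans (simpFace_vertex 1 2 0).symm
  simp only [h', ContinuousMap.comp_apply, v₀, v₁, v₂]
  grind

/-- Evaluation on the fundamental cycle, on the second cohomology group of the torus. -/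
def torusH2Eval : SingularH2 Torus (ZMod 2) →+ ZMod 2 :=
  QuotientAddGroup.lift _ (evalFundamental.comp (AddSubgroup.subtype _)) (by
    rintro ⟨f, hf⟩ hr
    obtain ⟨g, rfl⟩ := AddSubgroup.mem_addSubgroupOf.1 hr
    exact evalFundamental_coboundary g)

theorem torusH2Eval_injective : Function.Injective torusH2Eval := by
  rw [injective_iff_map_eq_zero]
  intro a ha
  obtain ⟨⟨f, hf⟩, rfl⟩ := QuotientAddGroup.mk_surjective a
  obtain ⟨g, hg⟩ := exists_primitive_of_evalFundamental hf ha
  rw [QuotientAddGroup.eq_zero_iff, AddSubgroup.mem_addSubgroupOf]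
  exact ⟨g, hg⟩

/-- Injectivity bounds H² by ℤ/2; any non-zero class then gives surjectivity, so no separate
generator has to be constructed. -/
theorem exists_addEquiv_of_ne_zero {w : SingularH2 Torus (ZMod 2)} (hw : w ≠ 0) :
    ∃ φ : SingularH2 Torus (ZMod 2) ≃+ ZMod 2, φ w = 1 := by
  have h1 : torusH2Eval w = 1 := (ZMod.two_eq_zero_or_one _).resolve_left fun h =>
    hw (torusH2Eval_injective (h.trans (map_zero _).symm))
  have hsurj : Function.Surjective torusH2Eval := fun x =>
    (ZMod.two_eq_zero_or_one x).elim (fun h => ⟨0, by rw [map_zero, h]⟩)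
      fun h => ⟨w, by rw [h1, h]⟩
  exact ⟨AddEquiv.ofBijective torusH2Eval ⟨torusH2Eval_injective, hsurj⟩, h1⟩

/-! ### The second Stiefel–Whitney class of a flat bundle over the torus -/

section StiefelWhitney

variable (ζ : Multiplicative (ℤ × ℤ) →* SO3)

/-- The class in `H²(T²; ℤ/2)` of the extension cocycle. -/
def torusExtClass : SingularH2 Torus (ZMod 2) :=
  QuotientAddGroup.mk ⟨torusExtCocycle ζ, torusExtCocycle_mem ζ⟩

theorem displacement_straightEdge (n : ℤ × ℤ) :
    displacement (straightEdge 0 (latticeVec n)) = n := by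
  have hp : ∀ m, torusProj (latticeVec m) = torusProj (torusLift 0) := fun m => by
    rw [torusProj_latticeVec, torusProj_torusLift]
  have h₀ : straightEdge 0 (latticeVec n) (stdSimplex.vertex 0) = 0 :=
    (congrArg torusProj (affineSimplex_vertex ![0, latticeVec n] 0)).trans (map_zero _)
  have h₁ : straightEdge 0 (latticeVec n) (stdSimplex.vertex 1) = 0 :=
    (congrArg torusProj (affineSimplex_vertex ![0, latticeVec n] 1)).trans (torusProj_latticeVec n)
  obtain ⟨a, ha⟩ := exists_latticeVec_of_torusProj_eq (hp 0)
  rw [displacement_eq (L := affineSimplex ![0, latticeVec n]) (a := a) (b := a + n)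
    (fun t => rfl), add_sub_cancel_left]
  · rw [affineSimplex_vertex, h₀, ← ha, latticeVec_zero]
    rfl
  · rw [affineSimplex_vertex, h₁, latticeVec_add, ← add_assoc, ← ha, latticeVec_zero, zero_add]
    rfl

theorem torusH2Eval_torusExtClass :
    torusH2Eval (torusExtClass ζ) = extCocycle ζ (1, 0) (0, 1) + extCocycle ζ (0, 1) (1, 0) := by
  obtain ⟨h₀, -, h₂⟩ := lowerTriangle_face
  obtain ⟨k₀, -, k₂⟩ := upperTriangle_face
  change extCocycle ζ (displacement (lowerTriangle.comp (simpFace 1 2)))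
      (displacement (lowerTriangle.comp (simpFace 1 0))) +
    extCocycle ζ (displacement (upperTriangle.comp (simpFace 1 2)))
      (displacement (upperTriangle.comp (simpFace 1 0))) = _
  rw [h₀, h₂, k₀, k₂, ← latticeVec_one_zero, ← latticeVec_zero_one, displacement_straightEdge,
    displacement_straightEdge]

/-- The two products of the lifts are signs times the same lift for e₁ + e₂, so the values of the
cocycle agree exactly when the products do. -/
theorem torusExtClass_eq_zero_iff : torusExtClass ζ = 0 ↔
    Commute (latticeSpin ζ (1, 0)) (latticeSpin ζ (0, 1)) := by
  rw [← torusH2Eval_injective.eq_iff, map_zero, torusH2Eval_torusExtClass,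
    CharTwo.add_eq_zero, commute_iff_eq, latticeSpin_mul, latticeSpin_mul, add_comm (0, 1) (1, 0),
    quatSign_mul_eq_iff]

theorem FlatBundle.isSecondStiefelWhitneyClass {y₀ : Plane}
    (η : FundamentalGroup Torus (torusProj y₀) →* SO3) :
    IsSecondStiefelWhitneyClass (FlatBundle.proj η) (torusExtClass (FlatBundle.holonomy η)) where
  principal := FlatBundle.isPrincipalBundle η
  exists_section := FlatBundle.nonempty_oneSkeletonSection η
  represents s := by
    have hs := FlatBundle.obstruction_eq s
    have hmem : s.obstruction ∈ SingularTwoCocycle Torus (ZMod 2) := by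
      rw [hs]
      exact add_mem (singularCoboundary_singularCoboundary _) (torusExtCocycle_mem _)
    refine ⟨hmem, ?_⟩
    rw [torusExtClass, QuotientAddGroup.eq, AddSubgroup.mem_addSubgroupOf]
    -- Equality in the quotient concerns minus the left class plus the right one, whence the minus
    -- sign.
    refine ⟨-FlatBundle.edgeSign s, ?_⟩
    rw [map_neg]
    change _ = -s.obstruction + torusExtCocycle _
    rw [hs]
    abel

end StiefelWhitney

end

noncomputable section

open UnitQuaternion

/-! ### The Klein four-group -/

theorem kleinX₁_ne_one : kleinX₁ ≠ 1 := fun h => by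
  have := congrArg (fun R : SO3 => R.1 1 1) h
  norm_num [kleinX₁, diagSO3] at this

theorem kleinX₂_ne_one : kleinX₂ ≠ 1 := fun h => by
  have := congrArg (fun R : SO3 => R.1 0 0) h
  norm_num [kleinX₂, diagSO3] at this

theorem kleinX₃_ne_one : kleinX₃ ≠ 1 := fun h => by
  have := congrArg (fun R : SO3 => R.1 0 0) h
  norm_num [kleinX₃, diagSO3] at this

theorem kleinX₁_ne_kleinX₂ : kleinX₁ ≠ kleinX₂ := fun h => by
  have := congrArg (fun R : SO3 => R.1 0 0) h
  norm_num [kleinX₁, kleinX₂, diagSO3] at this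

theorem kleinX₁_ne_kleinX₃ : kleinX₁ ≠ kleinX₃ := fun h => by
  have := congrArg (fun R : SO3 => R.1 0 0) h
  norm_num [kleinX₁, kleinX₃, diagSO3] at this

theorem kleinX₂_ne_kleinX₃ : kleinX₂ ≠ kleinX₃ := fun h => by
  have := congrArg (fun R : SO3 => R.1 1 1) h
  norm_num [kleinX₂, kleinX₃, diagSO3] at this

theorem not_commute_unitI_unitJ : ¬ Commute unitI unitJ := fun h => by
  have h' : ((unitI : Quaternion ℝ) * unitJ).imK = ((unitJ : Quaternion ℝ) * unitI).imK :=
    congrArg (fun a : UnitQuaternion => (a : Quaternion ℝ).imK) h.eq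
  rw [Quaternion.imK_mul, Quaternion.imK_mul] at h'
  norm_num [unitI, unitJ, mk] at h'

theorem not_commute_unitJ_unitK : ¬ Commute unitJ unitK := fun h => by
  have h' : ((unitJ : Quaternion ℝ) * unitK).imI = ((unitK : Quaternion ℝ) * unitJ).imI :=
    congrArg (fun a : UnitQuaternion => (a : Quaternion ℝ).imI) h.eq
  rw [Quaternion.imI_mul, Quaternion.imI_mul] at h'
  norm_num [unitJ, unitK, mk] at h'

theorem not_commute_unitI_unitK : ¬ Commute unitI unitK := fun h => by
  have h' : ((unitI : Quaternion ℝ) * unitK).imJ = ((unitK : Quaternion ℝ) * unitI).imJ :=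
    congrArg (fun a : UnitQuaternion => (a : Quaternion ℝ).imJ) h.eq
  rw [Quaternion.imJ_mul, Quaternion.imJ_mul] at h'
  norm_num [unitI, unitK, mk] at h'

theorem commute_congr_of_spin_eq {a a' b b' : UnitQuaternion} (ha : spin a = spin a')
    (hb : spin b = spin b') : Commute a b ↔ Commute a' b' := by
  rcases (spin_eq_iff a a').1 ha with rfl | rfl <;> rcases (spin_eq_iff b b').1 hb with rfl | rfl
  · rfl
  · exact Commute.neg_right_iff
  · exact Commute.neg_left_iff
  · exact Commute.neg_left_iff.trans Commute.neg_right_iff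

/-- Lifts of elements of the Klein four-group commute unless the elements are distinct and
non-trivial. -/
theorem not_commute_iff_of_spin_mem {a b : UnitQuaternion} (ha : spin a ∈ V₄) (hb : spin b ∈ V₄) :
    ¬ Commute a b ↔ spin a ≠ 1 ∧ spin b ≠ 1 ∧ spin a ≠ spin b := by
  have hI := not_commute_unitI_unitJ
  have hJ := not_commute_unitJ_unitK
  have hK := not_commute_unitI_unitK
  have h1 : spin 1 = 1 := map_one spin
  -- Commutation is insensitive to signs, so the lifts may be taken among 1, i, j, k.
  have key : ∀ a' b', spin a = spin a' → spin b = spin b' →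
      (¬ Commute a' b' ↔ spin a' ≠ 1 ∧ spin b' ≠ 1 ∧ spin a' ≠ spin b') →
      (¬ Commute a b ↔ spin a ≠ 1 ∧ spin b ≠ 1 ∧ spin a ≠ spin b) := by
    intro a' b' ha hb h
    rw [commute_congr_of_spin_eq ha hb, ha, hb, h]
  have n1 := kleinX₁_ne_one
  have n2 := kleinX₂_ne_one
  have n3 := kleinX₃_ne_one
  have n12 := kleinX₁_ne_kleinX₂
  have n13 := kleinX₁_ne_kleinX₃
  have n23 := kleinX₂_ne_kleinX₃
  have hI' := mt Commute.symm hI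
  have hJ' := mt Commute.symm hJ
  have hK' := mt Commute.symm hK
  obtain ⟨a', ha', haS⟩ : ∃ a', spin a = spin a' ∧
      (a' = 1 ∨ a' = unitI ∨ a' = unitJ ∨ a' = unitK) := by
    rcases ha with h | h | h | h
    · exact ⟨1, h.trans h1.symm, by simp⟩
    · exact ⟨unitI, h.trans spin_unitI.symm, by simp⟩
    · exact ⟨unitJ, h.trans spin_unitJ.symm, by simp⟩
    · exact ⟨unitK, h.trans spin_unitK.symm, by simp⟩
  obtain ⟨b', hb', hbS⟩ : ∃ b', spin b = spin b' ∧
      (b' = 1 ∨ b' = unitI ∨ b' = unitJ ∨ b' = unitK) := by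
    rcases hb with h | h | h | h
    · exact ⟨1, h.trans h1.symm, by simp⟩
    · exact ⟨unitI, h.trans spin_unitI.symm, by simp⟩
    · exact ⟨unitJ, h.trans spin_unitJ.symm, by simp⟩
    · exact ⟨unitK, h.trans spin_unitK.symm, by simp⟩
  refine key a' b' ha' hb' ?_
  clear key ha hb ha' hb'
  rcases haS with rfl | rfl | rfl | rfl <;> rcases hbS with rfl | rfl | rfl | rfl <;>
    simp only [spin_unitI, spin_unitJ, spin_unitK, h1, Commute.one_left, Commute.one_right,
      Commute.refl, hI, hJ, hK, hI', hJ', hK', n1, n2, n3, n12, n13, n23, n12.symm, n13.symm,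
      n23.symm, ne_eq, not_true_eq_false, not_false_eq_true, and_true, and_false, false_and,
      true_and, and_self]

theorem V₄_mul_self {x : SO3} (hx : x ∈ V₄) : x * x = 1 := by
  obtain ⟨h₁, h₂, h₃⟩ := klein_mul_self
  rcases hx with rfl | rfl | rfl | rfl
  exacts [one_mul 1, h₁, h₂, h₃]

theorem eq_of_mem_V₄ {x y v : SO3} (hx : x ∈ V₄) (hy : y ∈ V₄) (hv : v ∈ V₄) (hx1 : x ≠ 1)
    (hy1 : y ≠ 1) (hxy : x ≠ y) : v = 1 ∨ v = x ∨ v = y ∨ v = x * y := by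
  obtain ⟨k₁, k₂, k₃, k₄, k₅, k₆⟩ := klein_mul
  rcases hx with rfl | rfl | rfl | rfl <;> rcases hy with rfl | rfl | rfl | rfl <;>
    first
    | exact absurd rfl hx1
    | exact absurd rfl hy1
    | exact absurd rfl hxy
    | (rcases hv with rfl | rfl | rfl | rfl <;>
        simp only [k₁, k₂, k₃, k₄, k₅, k₆, true_or, or_true])

theorem surjective_of_mem_range {H : Type*} [Group H] (θ : H →* V₄) {a b : H}
    (ha : θ a ≠ 1) (hb : θ b ≠ 1) (hab : θ a ≠ θ b) : Function.Surjective θ := by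
  intro v
  have hne : ∀ {u v : V₄}, u ≠ v → (u : SO3) ≠ v := fun h h' => h (Subtype.ext h')
  rcases eq_of_mem_V₄ (θ a).2 (θ b).2 v.2 (hne ha) (hne hb) (hne hab) with h | h | h | h
  · exact ⟨1, Subtype.ext ((congrArg Subtype.val (map_one θ)).trans h.symm)⟩
  · exact ⟨a, Subtype.ext h.symm⟩
  · exact ⟨b, Subtype.ext h.symm⟩
  · exact ⟨a * b, Subtype.ext ((congrArg Subtype.val (map_mul θ a b)).trans h.symm)⟩

theorem lattice_generation (n : Multiplicative (ℤ × ℤ)) :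
    n = Multiplicative.ofAdd (1, 0) ^ n.toAdd.1 * Multiplicative.ofAdd (0, 1) ^ n.toAdd.2 := by
  apply Multiplicative.toAdd.injective
  rw [toAdd_mul, toAdd_zpow, toAdd_zpow]
  refine Prod.ext ?_ ?_ <;> simp

/-- If one of the three conditions fails, the image is generated by a single element, whereas V₄ is
not cyclic because all its elements have square 1. -/
theorem surjective_iff_generators (θ : Multiplicative (ℤ × ℤ) →* V₄) :
    Function.Surjective θ ↔ θ (Multiplicative.ofAdd (1, 0)) ≠ 1 ∧
      θ (Multiplicative.ofAdd (0, 1)) ≠ 1 ∧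
      θ (Multiplicative.ofAdd (1, 0)) ≠ θ (Multiplicative.ofAdd (0, 1)) := by
  refine ⟨fun hs => ?_, fun h => surjective_of_mem_range θ h.1 h.2.1 h.2.2⟩
  have hgen : ∀ n, θ n = θ (Multiplicative.ofAdd (1, 0)) ^ n.toAdd.1 *
      θ (Multiplicative.ofAdd (0, 1)) ^ n.toAdd.2 := fun n => by
    conv_lhs => rw [lattice_generation n]
    rw [map_mul, map_zpow, map_zpow]
  have hcyc : ¬ ∃ z : V₄, ∀ v, ∃ m : ℤ, v = z ^ m := by
    rintro ⟨z, hz⟩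
    have hzz : z ^ 2 = 1 := by rw [pow_two]; exact Subtype.ext (V₄_mul_self z.2)
    have hz' : ∀ v : V₄, v ≠ 1 → v = z := fun v hv => by
      obtain ⟨m, rfl⟩ := hz v
      rcases Int.even_or_odd' m with ⟨k, rfl | rfl⟩
      · exact absurd (by rw [zpow_mul, zpow_ofNat, hzz, one_zpow]) hv
      · rw [zpow_add_one, zpow_mul, zpow_ofNat, hzz, one_zpow, one_mul]
    have h₁ := hz' ⟨kleinX₁, by simp [V₄, ← SetLike.mem_coe]⟩
      fun h => kleinX₁_ne_one (congrArg Subtype.val h)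
    have h₂ := hz' ⟨kleinX₂, by simp [V₄, ← SetLike.mem_coe]⟩
      fun h => kleinX₂_ne_one (congrArg Subtype.val h)
    exact kleinX₁_ne_kleinX₂ (congrArg Subtype.val (h₁.trans h₂.symm))
  refine ⟨fun h => hcyc ⟨θ (Multiplicative.ofAdd (0, 1)), fun v => ?_⟩,
    fun h => hcyc ⟨θ (Multiplicative.ofAdd (1, 0)), fun v => ?_⟩,
    fun h => hcyc ⟨θ (Multiplicative.ofAdd (0, 1)), fun v => ?_⟩⟩
  · obtain ⟨n, rfl⟩ := hs v
    exact ⟨n.toAdd.2, by rw [hgen n, h, one_zpow, one_mul]⟩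
  · obtain ⟨n, rfl⟩ := hs v
    exact ⟨n.toAdd.1, by rw [hgen n, h, one_zpow, mul_one]⟩
  · obtain ⟨n, rfl⟩ := hs v
    exact ⟨n.toAdd.1 + n.toAdd.2, by rw [hgen n, h, zpow_add]⟩

theorem torusExtClass_ne_zero_iff (θ : Multiplicative (ℤ × ℤ) →* V₄) :
    torusExtClass (V₄.subtype.comp θ) ≠ 0 ↔ Function.Surjective θ := by
  -- Elements of V₄ are their own inverses, so the minus sign in `latticeSpin` disappears.
  have hinv : ∀ n, spin (latticeSpin (V₄.subtype.comp θ) n) = θ (Multiplicative.ofAdd n) :=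
    fun n => by
      rw [spin_latticeSpin, ofAdd_neg, map_inv, inv_eq_iff_mul_eq_one]
      exact V₄_mul_self (θ (Multiplicative.ofAdd n)).2
  rw [ne_eq, torusExtClass_eq_zero_iff, not_commute_iff_of_spin_mem
    (by rw [hinv]; exact (θ _).2) (by rw [hinv]; exact (θ _).2), hinv, hinv,
    surjective_iff_generators]
  simp only [ne_eq, Subtype.ext_iff, OneMemClass.coe_one]

theorem torusExtClass_holonomy_ne_zero_iff {y₀ : Plane}
    (θ : FundamentalGroup Torus (torusProj y₀) →* V₄) :
    torusExtClass (FlatBundle.holonomy (V₄.subtype.comp θ)) ≠ 0 ↔ Function.Surjective θ :=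
  (torusExtClass_ne_zero_iff (θ.comp (latticeHom y₀))).trans
    ⟨fun h => Function.Surjective.of_comp h, fun h => h.comp (latticeHom_surjective y₀)⟩

theorem IsFreeAbelianBasis.exists_eq {π : Type*} [Group π] {a b : π} (h : IsFreeAbelianBasis a b)
    (c : π) : ∃ m n : ℤ, c = a ^ m * b ^ n := by
  obtain ⟨e, ha, hb⟩ := h
  refine ⟨(e c).toAdd.1, (e c).toAdd.2, e.injective ?_⟩
  rw [map_mul, map_zpow, map_zpow, ha, hb, ← lattice_generation]

end

/-! ### The theorem for an arbitrary base point -/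

theorem lemma4p2 (x₀ : Torus) :
    (∀ (η : FundamentalGroup Torus x₀ →* SO3) (a b : FundamentalGroup Torus x₀) (x y : SO3),
      IsFreeAbelianBasis a b → x ∈ V₄ → y ∈ V₄ → x ≠ 1 → y ≠ 1 → x ≠ y → η a = x → η b = y →
      ∃ w : SingularH2 Torus (ZMod 2),
        IsSecondStiefelWhitneyClass (FlatBundle.proj η) w ∧
        ∃ φ : SingularH2 Torus (ZMod 2) ≃+ ZMod 2, φ w = 1) ∧
    (∀ θ : FundamentalGroup Torus x₀ →* V₄,
      ∃ w : SingularH2 Torus (ZMod 2),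
        IsSecondStiefelWhitneyClass (FlatBundle.proj (V₄.subtype.comp θ)) w ∧
        (w ≠ 0 ↔ Function.Surjective θ)) := by
  obtain ⟨y₀, rfl⟩ := torusProj_surjective x₀
  constructor
  · intro η a b x y hab hx hy hx1 hy1 hxy hηa hηb
    -- A basis generates the group, so `η` takes values in V₄; two distinct non-trivial values make
    -- it onto, and the surjectivity criterion applies.
    have hη : ∀ c, η c ∈ V₄ := fun c => by
      obtain ⟨m, n, rfl⟩ := hab.exists_eq c
      rw [map_mul, map_zpow, map_zpow, hηa, hηb]
      exact V₄.mul_mem (V₄.zpow_mem hx m) (V₄.zpow_mem hy n)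
    let θ : FundamentalGroup Torus (torusProj y₀) →* V₄ := η.codRestrict V₄ hη
    have hne : ∀ {u v : V₄}, (u : SO3) ≠ v → u ≠ v := fun h h' => h (congrArg Subtype.val h')
    have hθ : Function.Surjective θ := surjective_of_mem_range θ (a := a) (b := b)
      (hne (by change η a ≠ 1; rwa [hηa])) (hne (by change η b ≠ 1; rwa [hηb]))
      (hne (by change η a ≠ η b; rwa [hηa, hηb]))
    exact ⟨_, FlatBundle.isSecondStiefelWhitneyClass η,
      exists_addEquiv_of_ne_zero ((torusExtClass_holonomy_ne_zero_iff θ).2 hθ)⟩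
  · intro θ
    exact ⟨_, FlatBundle.isSecondStiefelWhitneyClass _, torusExtClass_holonomy_ne_zero_iff θ⟩
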